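/- Let $\sigma,\beta,\lambda_p,\bar m,P_1,P_2,P_3>0$ and $\lambda_1,\lambda_3\ge 0$. Let $\Phi_1,\Phi_2,\Phi_3$ be independent point processes on $\mathbb{R}^2$ such that $\Phi_1$ and $\Phi_3$ are homogeneous Poisson point processes with intensities $\lambda_1$ and $\lambda_3$, and $\Phi_2=\bigcup_{j\ge1}(X_j+\Psi_j)$ (almost surely) is a Thomas cluster process: the distinct points $X_1,X_2,\dots$ form a homogeneous Poisson point process with intensity $\lambda_p$, and the $\Psi_j$ are Poisson point processes with intensity function $\bar m f_d(y)$, $f_d(y)=\exp(-\|y\|^2/(2\sigma^2))/(2\pi\sigma^2)$, independent of each other and of the sequence $(X_j)_j$. For $n\in\{1,2,3\}$ let $R_n=\inf_{x\in\Phi_n}\|x\|$ be the distance from the origin to the closest point of $\Phi_n$ and let $C_n=P_nR_n^{-\beta}$ be the maximum power received from tier $n$ ($R_n=\infty$ and $C_n=0$ if $\Phi_n=\emptyset$). Put $$I_0(x)=\frac1\pi\int_0^\pi e^{x\cos\varphi}\,d\varphi,\qquad q(a,b)=b\,e^{-(a^2+b^2)/2}I_0(ab),\qquad Q_1(a,b)=\int_b^\infty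 z\,e^{-(z^2+a^2)/2}I_0(az)\,dz,$$ $$\tau_i(r)=2\pi\lambda_i r\ \ (i=1,3),\qquad \tau_2(r)=\bar m\int_0^\infty 2\pi\lambda_p\frac z\sigma\,q\Big(\frac z\sigma,\frac r\sigma\Big)\exp\Big(-\bar m\Big(1-Q_1\Big(\frac z\sigma,\frac r\sigma\Big)\Big)\Big)dz .$$ Then for every $i\in\{1,2,3\}$ and every $r>0$ the integrals over $z$ above and below converge absolutely, and so does the integral over $r$ below, and $$\mathbb{P}\Big(C_i>\max_{n\ne i}C_n\Big)=\int_0^\infty \tau_i(r)\,\exp\Big(-\int_0^\infty 2\pi\lambda_p z\Big(1-\exp\Big(-\bar m\Big(1-Q_1\Big(\frac z\sigma,\frac{(P_2/P_i)^{1/\beta}r}{\sigma}\Big)\Big)\Big)\Big)dz\Big)\exp\Big(-\sum_{l\in\{1,3\}}\pi\lambda_l\Big(\frac{P_l}{P_i}\Big)^{2/\beta}r^2\Big)dr .$$ -/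

import Mathlib

open MeasureTheory ProbabilityTheory Set

open scoped ENNReal NNReal

noncomputable section

namespace HetNet

/-- The plane with its Euclidean norm. -/
abbrev Plane : Type := EuclideanSpace ℝ (Fin 2)

section PointProcesses

variable {Ω : Type*}

/-- Number of points of the random set `Φ` that lie in `A`. -/
def pointCount (Φ : Ω → Set Plane) (A : Set Plane) (ω : Ω) : ℕ∞ :=
  (Φ ω ∩ A).encard

/-- The σ-algebra generated by a random set of points, i.e. by its counts in Borel sets. -/
@[reducible] def pointSigma (Φ : Ω → Set Plane) : MeasurableSpace Ω :=
  ⨆ A : {A : Set Plane // MeasurableSet A},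
    MeasurableSpace.comap (pointCount Φ A.1) inferInstance

/-- A (simple) point process on the plane: a random locally finite set of points whose
counts in Borel sets are random variables. -/
structure IsPointProcess [MeasurableSpace Ω] (Φ : Ω → Set Plane) : Prop where
  locallyFinite : ∀ ω (ρ : ℝ), (Φ ω ∩ Metric.closedBall 0 ρ).Finite
  measurable_count : ∀ A : Set Plane, MeasurableSet A → Measurable (pointCount Φ A)

/-- A Poisson point process with intensity measure `Λ`. -/
structure IsPoissonProcess [MeasurableSpace Ω] (Φ : Ω → Set Plane) (Λ : Measure Plane)
    (μ : Measure Ω) : Prop extends IsPointProcess Φ where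
  count_law : ∀ A : Set Plane, MeasurableSet A → Λ A ≠ ∞ →
    μ.map (pointCount Φ A) = (poissonMeasure (Λ A).toNNReal).map (fun k : ℕ => (k : ℕ∞))
  count_indep : ∀ (n : ℕ) (A : Fin n → Set Plane), (∀ k, MeasurableSet (A k)) →
    Pairwise (fun k l => Disjoint (A k) (A l)) →
    iIndepFun (fun k => pointCount Φ (A k)) μ

/-- A homogeneous Poisson point process with intensity `lam`. -/
def IsHomogeneousPoisson [MeasurableSpace Ω] (Φ : Ω → Set Plane) (lam : ℝ)
    (μ : Measure Ω) : Prop :=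
  IsPoissonProcess Φ (ENNReal.ofReal lam • (volume : Measure Plane)) μ

/-- The displacement kernel: centred isotropic normal density on the plane. -/
def displacementKernel (σ : ℝ) (y : Plane) : ℝ :=
  Real.exp (-‖y‖ ^ 2 / (2 * σ ^ 2)) / (2 * Real.pi * σ ^ 2)

/-- The intensity measure of the daughters of one parent, relative to that parent. -/
def daughterIntensity (mbar σ : ℝ) : Measure Plane :=
  volume.withDensity (fun y => ENNReal.ofReal (mbar * displacementKernel σ y))

/-- The σ-algebras of the parent sequence (`none`) and of the marks (`some j`). -/
@[reducible] def parentMarkSigma (X : ℕ → Ω → Plane) (Ψ : ℕ → Ω → Set Plane) :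
    Option ℕ → MeasurableSpace Ω
  | none => ⨆ j, MeasurableSpace.comap (X j) inferInstance
  | some j => pointSigma (Ψ j)

/-- A Thomas cluster process: the union of `X j + Ψ j`, where the distinct points `X j` form a
homogeneous Poisson process of intensity `lamp`, each mark `Ψ j` is a Poisson process with
intensity function `mbar` times the displacement kernel, and the marks are independent of each
other and of the parents. -/
structure IsThomasProcess [MeasurableSpace Ω] (Φ : Ω → Set Plane) (lamp mbar σ : ℝ)
    (μ : Measure Ω) : Prop extends IsPointProcess Φ where
  exists_clusters : ∃ (X : ℕ → Ω → Plane) (Ψ : ℕ → Ω → Set Plane),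
    (∀ j, Measurable (X j)) ∧
    (∀ᵐ ω ∂μ, Function.Injective (fun j => X j ω)) ∧
    IsHomogeneousPoisson (fun ω => range (fun j => X j ω)) lamp μ ∧
    (∀ j, IsPoissonProcess (Ψ j) (daughterIntensity mbar σ) μ) ∧
    iIndep (parentMarkSigma X Ψ) μ ∧
    ∀ᵐ ω ∂μ, Φ ω = ⋃ j, (fun y => X j ω + y) '' Ψ j ω

/-- Distance from the origin to the closest point of a set (`∞` for the empty set). -/
def contactDistance (S : Set Plane) : ℝ≥0∞ := Metric.infEDist 0 S

/-- Maximum received power at the origin from nodes with transmit power `P` located at `S`,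
under path-loss exponent `β` (`0` for the empty set). -/
def receivedPower (P β : ℝ) (S : Set Plane) : ℝ≥0∞ :=
  ENNReal.ofReal P * contactDistance S ^ (-β)

end PointProcesses

/-- Modified Bessel function of the first kind of order zero. -/
def besselI0 (x : ℝ) : ℝ :=
  Real.pi⁻¹ * ∫ φ in (0 : ℝ)..Real.pi, Real.exp (x * Real.cos φ)

/-- Density at `b ≥ 0` of the Rice distribution with parameters `a` and `1`. -/
def ricePDF (a b : ℝ) : ℝ :=
  b * Real.exp (-(b ^ 2 + a ^ 2) / 2) * besselI0 (a * b)

/-- First-order Marcum Q-function. -/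
def marcumQ1 (a b : ℝ) : ℝ :=
  ∫ z in Ioi b, z * Real.exp (-(z ^ 2 + a ^ 2) / 2) * besselI0 (a * z)

/-- `2πλ_p z (1 - exp(-m̄ (1 - Q₁(z/σ, s/σ))))`. -/
def voidIntegrand (lamp mbar σ s z : ℝ) : ℝ :=
  2 * Real.pi * lamp * z * (1 - Real.exp (-(mbar * (1 - marcumQ1 (z / σ) (s / σ)))))

/-- `2πλ_p (z/σ) q(z/σ, r/σ) exp(-m̄ (1 - Q₁(z/σ, r/σ)))`. -/
def clusterIntegrand (lamp mbar σ r z : ℝ) : ℝ :=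
  2 * Real.pi * lamp * (z / σ) * ricePDF (z / σ) (r / σ) *
    Real.exp (-(mbar * (1 - marcumQ1 (z / σ) (r / σ))))

/-- The function `τ_i`; the indices `0, 1, 2` stand for the tiers 1, 2, 3. -/
def tau (lam1 lam3 lamp mbar σ : ℝ) (i : Fin 3) (r : ℝ) : ℝ :=
  match i with
  | 0 => 2 * Real.pi * lam1 * r
  | 1 => mbar * ∫ z in Ioi (0 : ℝ), clusterIntegrand lamp mbar σ r z
  | 2 => 2 * Real.pi * lam3 * r

/-- The integrand of the association probability of tier `i`. -/
def associationIntegrand (lam1 lam3 lamp mbar σ β : ℝ) (P : Fin 3 → ℝ) (i : Fin 3)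
    (r : ℝ) : ℝ :=
  tau lam1 lam3 lamp mbar σ i r *
    Real.exp (-∫ z in Ioi (0 : ℝ), voidIntegrand lamp mbar σ ((P 1 / P i) ^ (1 / β) * r) z) *
    Real.exp (-(Real.pi * lam1 * (P 0 / P i) ^ (2 / β) * r ^ 2 +
      Real.pi * lam3 * (P 2 / P i) ^ (2 / β) * r ^ 2))

end HetNet

end

/-!
The contact distances `R n` of the three tiers are independent, and each is determined by its
survival function `s ↦ exp (-V n s)`, the probability that the disc of radius `s` around the origin
is empty. With `c n = (P n / P i) ^ (1 / β)`, tier `n` is received more weakly than tier `i` exactly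
when `c n * R i < R n` (`receivedPower_lt_iff`). Freezing `R i` by independence, the association
probability is the integral of `∏ exp (-V n (c n * r))` over `n ≠ i` against the law of `R i`, which
on the event `R i < ∞` has density `V i' * exp (-V i)` (`measure_forall_mul_lt`). So the proof
consists in computing `V n` and in checking that its derivative is `tau n`.

For a homogeneous Poisson process `V n s = π λ s²` is immediate. For the Thomas process, freeze the
parents: the clusters miss the disc independently, the one of a parent at `x` with probability
`exp (-H x)`, where `H x` is its mean number of points in the disc. Hence the void probability is
the Laplace functional at `H` of the Poisson process of the parents,
`exp (-∫ (1 - exp (-H)) dΛ)`; the Laplace functional is computed for simple functions, where counts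
in disjoint sets are independent Poisson variables, and extended by monotone approximation
(`IsPoissonProcess.lintegral_expNeg`). In polar coordinates the Gaussian mass of a disc is a Rice
distribution function, so `H x = mbar * (1 - Q₁(‖x‖ / σ, s / σ))` (`daughterIntensity_closedBall`,
`one_sub_marcumQ1`), and a second use of polar coordinates turns the integral over `x` into that of
`voidIntegrand` (`IsThomasProcess.measure_inter_closedBall_eq_empty`). Differentiation under the
integral sign (`hasDerivAt_voidExponent`) gives `tau`; both the domination and the integrability
claims follow from the bound `q(a, b) ≤ b exp (b² / 2) exp (-a² / 4)`, a consequence of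
`I₀(x) ≤ exp |x|`.
-/

open MeasureTheory ProbabilityTheory Set

open scoped ENNReal NNReal

namespace HetNet

/-! ### The Bessel function `I₀` -/

theorem continuous_besselI0 : Continuous besselI0 := by
  unfold besselI0
  refine continuous_const.mul ?_
  refine intervalIntegral.continuous_parametric_intervalIntegral_of_continuous
    (f := fun x φ => Real.exp (x * Real.cos φ)) ?_ continuous_const
  unfold Function.uncurry
  fun_prop

theorem besselI0_nonneg (x : ℝ) : 0 ≤ besselI0 x :=
  mul_nonneg (by positivity)
    (intervalIntegral.integral_nonneg Real.pi_pos.le fun _ _ => (Real.exp_pos _).le)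

theorem besselI0_le (x : ℝ) : besselI0 x ≤ Real.exp |x| := by
  have h : ∫ φ in (0 : ℝ)..Real.pi, Real.exp (x * Real.cos φ) ≤
      ∫ _ in (0 : ℝ)..Real.pi, Real.exp |x| := by
    refine intervalIntegral.integral_mono_on Real.pi_pos.le
      (Continuous.intervalIntegrable (by fun_prop) _ _)
      (Continuous.intervalIntegrable (by fun_prop) _ _) fun φ _ => ?_
    refine Real.exp_le_exp.2 ((le_abs_self _).trans ?_)
    rw [abs_mul]
    exact mul_le_of_le_one_right (abs_nonneg x) (Real.abs_cos_le_one φ)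
  rw [intervalIntegral.integral_const, sub_zero, smul_eq_mul] at h
  unfold besselI0
  rw [inv_mul_le_iff₀ Real.pi_pos]
  exact h

/-- The Bessel function as an average over a full circle, with an arbitrary phase. -/
theorem integral_exp_mul_cos_add (x α : ℝ) :
    ∫ θ in -Real.pi..Real.pi, Real.exp (x * Real.cos (θ + α)) = 2 * Real.pi * besselI0 x := by
  have hper : Function.Periodic (fun θ => Real.exp (x * Real.cos θ)) (2 * Real.pi) := fun θ => by
    simp
  have h1 : ∫ θ in -Real.pi..Real.pi, Real.exp (x * Real.cos (θ + α)) =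
      ∫ θ in -Real.pi..Real.pi, Real.exp (x * Real.cos θ) := by
    rw [intervalIntegral.integral_comp_add_right (fun θ => Real.exp (x * Real.cos θ)) α]
    have := hper.intervalIntegral_add_eq (-Real.pi + α) (-Real.pi)
    convert this using 2 <;> ring
  have hint : ∀ a b : ℝ,
      IntervalIntegrable (fun θ => Real.exp (x * Real.cos θ)) volume a b :=
    fun a b => Continuous.intervalIntegrable (by fun_prop) _ _
  have h2 : ∫ θ in -Real.pi..0, Real.exp (x * Real.cos θ) =
      ∫ θ in (0 : ℝ)..Real.pi, Real.exp (x * Real.cos θ) := by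
    have := intervalIntegral.integral_comp_neg (a := 0) (b := Real.pi)
      (fun θ => Real.exp (x * Real.cos θ))
    simp only [Real.cos_neg, neg_zero] at this
    exact this.symm
  rw [h1, ← intervalIntegral.integral_add_adjacent_intervals (hint _ 0) (hint 0 _), h2]
  unfold besselI0
  field_simp
  ring

/-! ### The Rice distribution -/

theorem continuous_ricePDF : Continuous (Function.uncurry ricePDF) := by
  unfold Function.uncurry ricePDF
  have := continuous_besselI0
  fun_prop

theorem ricePDF_nonneg {a b : ℝ} (hb : 0 ≤ b) : 0 ≤ ricePDF a b :=
  mul_nonneg (mul_nonneg hb (Real.exp_pos _).le) (besselI0_nonneg _)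

/-- Since `I₀(x) ≤ exp |x|`, the density is at most `b * exp (-(a - b) ^ 2 / 2)`. The form below
has Gaussian decay in `a`, locally uniformly in `b`. -/
theorem ricePDF_le {a b : ℝ} (ha : 0 ≤ a) (hb : 0 ≤ b) :
    ricePDF a b ≤ b * Real.exp (b ^ 2 / 2) * Real.exp (-a ^ 2 / 4) := by
  unfold ricePDF
  rw [mul_assoc, mul_assoc]
  refine mul_le_mul_of_nonneg_left ?_ hb
  calc Real.exp (-(b ^ 2 + a ^ 2) / 2) * besselI0 (a * b)
      ≤ Real.exp (-(b ^ 2 + a ^ 2) / 2) * Real.exp (a * b) := by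
        refine mul_le_mul_of_nonneg_left ?_ (Real.exp_pos _).le
        exact (besselI0_le _).trans_eq (by rw [abs_of_nonneg (mul_nonneg ha hb)])
    _ ≤ Real.exp (b ^ 2 / 2) * Real.exp (-a ^ 2 / 4) := by
        rw [← Real.exp_add, ← Real.exp_add]
        refine Real.exp_le_exp.2 ?_
        nlinarith [sq_nonneg (a - 2 * b)]

/-- The Rice distribution function. Unlike `1 - marcumQ1 a b`, with which it agrees for
`a, b ≥ 0` (`one_sub_marcumQ1`), it is an integral over a bounded interval, whose joint continuity
and derivative in `b` are immediate. -/
noncomputable def riceCDF (a b : ℝ) : ℝ := ∫ t in (0 : ℝ)..b, ricePDF a t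

theorem continuous_riceCDF : Continuous (Function.uncurry riceCDF) :=
  intervalIntegral.continuous_parametric_primitive_of_continuous continuous_ricePDF

theorem riceCDF_nonneg {a b : ℝ} (hb : 0 ≤ b) : 0 ≤ riceCDF a b :=
  intervalIntegral.integral_nonneg hb fun _ ht => ricePDF_nonneg ht.1

theorem continuous_ricePDF_right (a : ℝ) : Continuous (ricePDF a) :=
  continuous_ricePDF.comp (Continuous.prodMk_right a)

theorem hasDerivAt_riceCDF (a b : ℝ) : HasDerivAt (riceCDF a) (ricePDF a b) b :=
  intervalIntegral.integral_hasDerivAt_right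
    ((continuous_ricePDF_right a).intervalIntegrable _ _)
    ((continuous_ricePDF_right a).stronglyMeasurableAtFilter _ _)
    (continuous_ricePDF_right a).continuousAt

theorem riceCDF_le {a b : ℝ} (ha : 0 ≤ a) (hb : 0 ≤ b) :
    riceCDF a b ≤ b ^ 2 * Real.exp (b ^ 2 / 2) * Real.exp (-a ^ 2 / 4) := by
  have : riceCDF a b ≤ ∫ _ in (0 : ℝ)..b, b * Real.exp (b ^ 2 / 2) * Real.exp (-a ^ 2 / 4) := by
    refine intervalIntegral.integral_mono_on hb
      ((continuous_ricePDF_right a).intervalIntegrable _ _)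
      (Continuous.intervalIntegrable (by fun_prop) _ _) fun t ht => ?_
    refine (ricePDF_le ha ht.1).trans ?_
    have h0 := ht.1
    have h1 := ht.2
    gcongr
  refine this.trans_eq ?_
  rw [intervalIntegral.integral_const, smul_eq_mul]
  ring

/-! ### Polar coordinates and Gaussian mass of discs -/

/-- Integration over the plane in polar coordinates. The angle is measured from the
direction of the first coordinate axis of `ℂ`, identified isometrically with the plane. -/
theorem lintegral_plane_polar {f : Plane → ℝ≥0∞} (hf : Measurable f) :
    ∫⁻ w, f w = ∫⁻ t in Ioi (0 : ℝ), ENNReal.ofReal t *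
      ∫⁻ θ in Ioo (-Real.pi) Real.pi, f (Complex.orthonormalBasisOneI.repr
        (t * (Real.cos θ + Real.sin θ * Complex.I))) := by
  set L := Complex.orthonormalBasisOneI.repr
  have hL : MeasurePreserving L volume volume :=
    Complex.orthonormalBasisOneI.measurePreserving_repr
  have hfL : Measurable (fun z => f (L z)) := hf.comp hL.measurable
  rw [← hL.lintegral_comp hf, ← Complex.lintegral_comp_polarCoord_symm]
  rw [show polarCoord.target = Ioi (0 : ℝ) ×ˢ Ioo (-Real.pi) Real.pi from rfl,
    Measure.volume_eq_prod, ← Measure.prod_restrict, lintegral_prod]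
  · refine lintegral_congr fun t => ?_
    rw [← lintegral_const_mul']
    · refine lintegral_congr fun θ => ?_
      simp [Complex.polarCoord_symm_apply]
    · simp
  · refine Measurable.aemeasurable ?_
    simp only [smul_eq_mul, Complex.polarCoord_symm_apply]
    refine (by fun_prop : Measurable fun p : ℝ × ℝ => ENNReal.ofReal p.1).mul (hfL.comp ?_)
    fun_prop

theorem norm_polar {t : ℝ} (ht : 0 ≤ t) (θ : ℝ) :
    ‖(t * (Real.cos θ + Real.sin θ * Complex.I) : ℂ)‖ = t := by
  rw [norm_mul, Complex.norm_real, Real.norm_of_nonneg ht]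
  have : ‖(Real.cos θ + Real.sin θ * Complex.I : ℂ)‖ = 1 := by
    push_cast
    rw [← Complex.exp_mul_I]
    exact Complex.norm_exp_ofReal_mul_I θ
  rw [this, mul_one]

/-- Integration of a radial function over the plane. -/
theorem lintegral_plane_norm {φ : ℝ → ℝ≥0∞} (hφ : Measurable φ) :
    ∫⁻ w : Plane, φ ‖w‖ = ∫⁻ t in Ioi (0 : ℝ), ENNReal.ofReal (2 * Real.pi * t) * φ t := by
  rw [lintegral_plane_polar (f := fun w => φ ‖w‖) (by fun_prop)]
  refine setLIntegral_congr_fun measurableSet_Ioi fun t ht => ?_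
  simp only [LinearIsometryEquiv.norm_map, norm_polar (le_of_lt ht)]
  rw [lintegral_const, Measure.restrict_apply_univ, Real.volume_Ioo, mul_comm (2 * Real.pi),
    ENNReal.ofReal_mul (le_of_lt ht)]
  rw [show Real.pi - -Real.pi = 2 * Real.pi by ring]
  ring

/-- The law of cosines; the shift of the angle by `π` makes the cosine term negative. -/
theorem norm_add_polar_sq (c : ℂ) (t θ : ℝ) :
    ‖c + t * (Real.cos θ + Real.sin θ * Complex.I)‖ ^ 2 =
      t ^ 2 + ‖c‖ ^ 2 - 2 * t * ‖c‖ * Real.cos (θ + (Real.pi - c.arg)) := by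
  have hre := Complex.norm_mul_cos_arg c
  have him := Complex.norm_mul_sin_arg c
  rw [show θ + (Real.pi - c.arg) = (θ - c.arg) + Real.pi by ring, Real.cos_add_pi, Real.cos_sub]
  rw [← Complex.normSq_eq_norm_sq, ← Complex.normSq_eq_norm_sq, Complex.normSq_apply,
    Complex.normSq_apply]
  have h1 : 2 * t * ‖c‖ * -(Real.cos θ * Real.cos c.arg + Real.sin θ * Real.sin c.arg) =
      -(2 * t * (Real.cos θ * c.re + Real.sin θ * c.im)) := by
    rw [← hre, ← him]; ring
  rw [h1]
  simp only [Complex.add_re, Complex.mul_re, Complex.ofReal_re, Complex.ofReal_im, Complex.add_im,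
    Complex.mul_im, Complex.I_re, Complex.I_im]
  have := Real.sin_sq_add_cos_sq θ
  linear_combination t ^ 2 * this

/-- The distance from `x` of a centred Gaussian point has the Rice density. -/
theorem lintegral_norm_mul_displacementKernel {σ : ℝ} (hσ : 0 < σ) (x : Plane) {φ : ℝ → ℝ≥0∞}
    (hφ : Measurable φ) :
    ∫⁻ w, φ ‖w‖ * ENNReal.ofReal (displacementKernel σ (x + w)) =
      ∫⁻ t in Ioi (0 : ℝ), φ t * ENNReal.ofReal (σ⁻¹ * ricePDF (‖x‖ / σ) (t / σ)) := by
  rw [lintegral_plane_polar (by unfold displacementKernel; fun_prop)]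
  refine setLIntegral_congr_fun measurableSet_Ioi fun t ht => ?_
  have ht' : 0 ≤ t := le_of_lt ht
  simp only [LinearIsometryEquiv.norm_map, norm_polar ht']
  obtain ⟨c, rfl⟩ := Complex.orthonormalBasisOneI.repr.surjective x
  simp only [← map_add, displacementKernel, LinearIsometryEquiv.norm_map, norm_add_polar_sq]
  set α := Real.pi - c.arg
  have key : ∀ θ : ℝ, Real.exp (-(t ^ 2 + ‖c‖ ^ 2 - 2 * t * ‖c‖ * Real.cos (θ + α)) /
      (2 * σ ^ 2)) / (2 * Real.pi * σ ^ 2) =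
      (Real.exp (-((t / σ) ^ 2 + (‖c‖ / σ) ^ 2) / 2) / (2 * Real.pi * σ ^ 2)) *
        Real.exp ((‖c‖ / σ * (t / σ)) * Real.cos (θ + α)) := by
    intro θ
    rw [div_mul_eq_mul_div, ← Real.exp_add]
    congr 2
    field_simp
    ring
  simp only [key]
  have hcirc : ∫⁻ θ in Ioo (-Real.pi) Real.pi,
      ENNReal.ofReal (Real.exp ((‖c‖ / σ * (t / σ)) * Real.cos (θ + α))) =
      ENNReal.ofReal (2 * Real.pi * besselI0 (‖c‖ / σ * (t / σ))) := by
    rw [← integral_exp_mul_cos_add _ α, intervalIntegral.integral_of_le (by linarith [Real.pi_pos]),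
      restrict_Ioo_eq_restrict_Ioc, ofReal_integral_eq_lintegral_ofReal]
    · exact (Continuous.intervalIntegrable (by fun_prop) _ _).1
    · exact ae_of_all _ fun _ => (Real.exp_pos _).le
  have hexp : ∀ θ : ℝ, φ t * ENNReal.ofReal
      (Real.exp (-((t / σ) ^ 2 + (‖c‖ / σ) ^ 2) / 2) / (2 * Real.pi * σ ^ 2) *
        Real.exp ((‖c‖ / σ * (t / σ)) * Real.cos (θ + α))) =
      φ t * ENNReal.ofReal
        (Real.exp (-((t / σ) ^ 2 + (‖c‖ / σ) ^ 2) / 2) / (2 * Real.pi * σ ^ 2)) *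
        ENNReal.ofReal (Real.exp ((‖c‖ / σ * (t / σ)) * Real.cos (θ + α))) := fun θ => by
    rw [ENNReal.ofReal_mul (by positivity)]
    exact (mul_assoc _ _ _).symm
  simp only [hexp]
  rw [lintegral_const_mul _ (by fun_prop), hcirc, mul_assoc, mul_left_comm,
    ← ENNReal.ofReal_mul (by positivity), ← ENNReal.ofReal_mul ht']
  congr 2
  unfold ricePDF
  field_simp

theorem lintegral_displacementKernel {σ : ℝ} (hσ : 0 < σ) :
    ∫⁻ w, ENNReal.ofReal (displacementKernel σ w) = 1 := by
  have h := GaussianFourier.integral_rexp_neg_mul_sq_norm (V := Plane)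
    (b := 1 / (2 * σ ^ 2)) (by positivity)
  have h2 : Real.pi / (1 / (2 * σ ^ 2)) = 2 * Real.pi * σ ^ 2 := by field_simp
  rw [h2, finrank_euclideanSpace_fin] at h
  norm_num at h
  have hne : (2 * Real.pi * σ ^ 2) ≠ 0 := by positivity
  have hint : Integrable fun w : Plane => Real.exp (-(1 / (2 * σ ^ 2)) * ‖w‖ ^ 2) := by
    refine Integrable.of_integral_ne_zero ?_
    norm_num
    rw [h]
    positivity
  have heq : displacementKernel σ =
      fun w : Plane => Real.exp (-(1 / (2 * σ ^ 2)) * ‖w‖ ^ 2) / (2 * Real.pi * σ ^ 2) := by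
    funext w
    unfold displacementKernel
    congr 2
    ring
  rw [← ofReal_integral_eq_lintegral_ofReal, heq, integral_div]
  · norm_num
    rw [h]
    field_simp
  · rw [heq]; exact hint.div_const _
  · exact ae_of_all _ fun w => by unfold displacementKernel; positivity

/-- The Rice density has mass one, being the density of the distance of a standard Gaussian point
from a point of norm `a`. -/
theorem lintegral_ricePDF {a : ℝ} (ha : 0 ≤ a) :
    ∫⁻ t in Ioi (0 : ℝ), ENNReal.ofReal (ricePDF a t) = 1 := by
  obtain ⟨x, hx⟩ := NormedSpace.exists_lt_norm ℝ Plane a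
  have hx0 : ‖x‖ ≠ 0 := (ha.trans_lt hx).ne'
  have hy : ‖(a / ‖x‖) • x‖ = a := by
    rw [norm_smul, Real.norm_of_nonneg (by positivity)]
    field_simp
  have h := lintegral_norm_mul_displacementKernel one_pos ((a / ‖x‖) • x) (φ := fun _ => 1)
    measurable_const
  simp only [one_mul, hy, inv_one, div_one] at h
  rw [← h, lintegral_add_left_eq_self (fun w => ENNReal.ofReal (displacementKernel 1 w)),
    lintegral_displacementKernel one_pos]

theorem one_sub_marcumQ1 {a b : ℝ} (ha : 0 ≤ a) (hb : 0 ≤ b) :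
    1 - marcumQ1 a b = riceCDF a b := by
  have hnn : 0 ≤ᵐ[volume.restrict (Ioi 0)] ricePDF a :=
    (ae_restrict_iff' measurableSet_Ioi).2 (ae_of_all _ fun t ht => ricePDF_nonneg (le_of_lt ht))
  have hmeas := (continuous_ricePDF_right a).aestronglyMeasurable
    (μ := volume.restrict (Ioi (0 : ℝ)))
  have hint : IntegrableOn (ricePDF a) (Ioi 0) := by
    refine ⟨hmeas, ?_⟩
    rw [hasFiniteIntegral_iff_ofReal hnn, lintegral_ricePDF ha]
    exact ENNReal.one_lt_top
  have htot : ∫ t in Ioi (0 : ℝ), ricePDF a t = 1 := by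
    rw [integral_eq_lintegral_of_nonneg_ae hnn hmeas, lintegral_ricePDF ha, ENNReal.toReal_one]
  have hQ : marcumQ1 a b = ∫ t in Ioi b, ricePDF a t := rfl
  rw [hQ, ← htot, riceCDF]
  exact (intervalIntegral.integral_Ioi_sub_Ioi hint hb)

/-- The mean number of daughters, of a parent at `-x`, in the disc of radius `s` around the
origin. -/
theorem daughterIntensity_closedBall {mbar σ s : ℝ} (hm : 0 ≤ mbar) (hσ : 0 < σ) (hs : 0 ≤ s)
    (x : Plane) :
    daughterIntensity mbar σ (Metric.closedBall x s) =
      ENNReal.ofReal (mbar * riceCDF (‖x‖ / σ) (s / σ)) := by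
  have hmk : Measurable fun w : Plane => ENNReal.ofReal (displacementKernel σ w) := by
    unfold displacementKernel; fun_prop
  have h := lintegral_norm_mul_displacementKernel hσ x (φ := (Iic s).indicator 1)
    (measurable_one.indicator measurableSet_Iic)
  have hL : ∫⁻ w : Plane, (Iic s).indicator 1 ‖w‖ *
      ENNReal.ofReal (displacementKernel σ (x + w)) =
      ∫⁻ y in Metric.closedBall x s, ENNReal.ofReal (displacementKernel σ y) := by
    rw [← lintegral_indicator Metric.isClosed_closedBall.measurableSet,
      ← lintegral_add_left_eq_self ((Metric.closedBall x s).indicator _) x]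
    refine lintegral_congr fun w => ?_
    by_cases hw : ‖w‖ ≤ s <;> simp [indicator, hw]
  have hR : ∫⁻ t in Ioi (0 : ℝ), (Iic s).indicator 1 t *
      ENNReal.ofReal (σ⁻¹ * ricePDF (‖x‖ / σ) (t / σ)) =
      ENNReal.ofReal (riceCDF (‖x‖ / σ) (s / σ)) := by
    have h1 : ∀ t : ℝ, (Iic s).indicator 1 t *
        ENNReal.ofReal (σ⁻¹ * ricePDF (‖x‖ / σ) (t / σ)) =
        (Iic s).indicator (fun t => ENNReal.ofReal (σ⁻¹ * ricePDF (‖x‖ / σ) (t / σ))) t := by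
      intro t
      simp [indicator]
    have hc : Continuous fun t => σ⁻¹ * ricePDF (‖x‖ / σ) (t / σ) :=
      continuous_const.mul ((continuous_ricePDF_right _).comp (continuous_id.div_const σ))
    simp only [h1]
    rw [setLIntegral_indicator measurableSet_Iic, inter_comm, Ioi_inter_Iic,
      ← ofReal_integral_eq_lintegral_ofReal, ← intervalIntegral.integral_of_le hs,
      intervalIntegral.integral_const_mul, intervalIntegral.integral_comp_div _ hσ.ne', riceCDF,
      zero_div, smul_eq_mul, inv_mul_cancel_left₀ hσ.ne']
    · exact (hc.intervalIntegrable 0 s).1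
    · refine (ae_restrict_iff' measurableSet_Ioc).2 (ae_of_all _ fun t ht => ?_)
      exact mul_nonneg (by positivity) (ricePDF_nonneg (div_nonneg ht.1.le hσ.le))
  rw [daughterIntensity, withDensity_apply _ Metric.isClosed_closedBall.measurableSet,
    ENNReal.ofReal_mul hm, ← hR, ← h, hL, ← lintegral_const_mul _ hmk]
  simp only [ENNReal.ofReal_mul hm]

/-! ### The void exponent of the Thomas process -/

/-- Minus the logarithm of the probability that a Thomas process has no point in the disc of
radius `s` at the origin. -/
noncomputable def voidExponent (lamp mbar σ s : ℝ) : ℝ :=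
  ∫ z in Ioi (0 : ℝ), voidIntegrand lamp mbar σ s z

theorem voidIntegrand_eq {lamp mbar σ s z : ℝ} (hσ : 0 < σ) (hs : 0 ≤ s) (hz : 0 ≤ z) :
    voidIntegrand lamp mbar σ s z =
      2 * Real.pi * lamp * z * (1 - Real.exp (-(mbar * riceCDF (z / σ) (s / σ)))) := by
  rw [voidIntegrand, one_sub_marcumQ1 (by positivity) (by positivity)]

theorem clusterIntegrand_eq {lamp mbar σ r z : ℝ} (hσ : 0 < σ) (hr : 0 ≤ r) (hz : 0 ≤ z) :
    clusterIntegrand lamp mbar σ r z =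
      2 * Real.pi * lamp * (z / σ) * ricePDF (z / σ) (r / σ) *
        Real.exp (-(mbar * riceCDF (z / σ) (r / σ))) := by
  rw [clusterIntegrand, one_sub_marcumQ1 (by positivity) (by positivity)]

theorem voidIntegrand_nonneg {lamp mbar σ s z : ℝ} (hl : 0 ≤ lamp) (hm : 0 ≤ mbar) (hσ : 0 < σ)
    (hs : 0 ≤ s) (hz : 0 ≤ z) : 0 ≤ voidIntegrand lamp mbar σ s z := by
  rw [voidIntegrand_eq hσ hs hz]
  have := mul_nonneg hm (riceCDF_nonneg (a := z / σ) (div_nonneg hs hσ.le))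
  refine mul_nonneg (by positivity) (sub_nonneg.2 (Real.exp_le_one_iff.2 (by linarith)))

theorem voidIntegrand_le {lamp mbar σ s z : ℝ} (hl : 0 ≤ lamp) (hm : 0 ≤ mbar) (hσ : 0 < σ)
    (hs : 0 ≤ s) (hz : 0 ≤ z) : voidIntegrand lamp mbar σ s z ≤
      2 * Real.pi * lamp * mbar * ((s / σ) ^ 2 * Real.exp ((s / σ) ^ 2 / 2)) *
        (z * Real.exp (-(1 / (4 * σ ^ 2)) * z ^ 2)) := by
  rw [voidIntegrand_eq hσ hs hz]
  have h1 := Real.add_one_le_exp (-(mbar * riceCDF (z / σ) (s / σ)))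
  have h2 := riceCDF_le (a := z / σ) (b := s / σ) (by positivity) (by positivity)
  have h3 : -(z / σ) ^ 2 / 4 = -(1 / (4 * σ ^ 2)) * z ^ 2 := by field_simp
  rw [h3] at h2
  calc _ ≤ 2 * Real.pi * lamp * z * (mbar * ((s / σ) ^ 2 * Real.exp ((s / σ) ^ 2 / 2) *
        Real.exp (-(1 / (4 * σ ^ 2)) * z ^ 2))) := by
        refine mul_le_mul_of_nonneg_left ?_ (by positivity)
        refine le_trans (by linarith) (mul_le_mul_of_nonneg_left h2 hm)
    _ = _ := by ring

theorem clusterIntegrand_nonneg {lamp mbar σ r z : ℝ} (hl : 0 ≤ lamp) (hσ : 0 < σ)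
    (hr : 0 ≤ r) (hz : 0 ≤ z) : 0 ≤ clusterIntegrand lamp mbar σ r z :=
  mul_nonneg (mul_nonneg (by positivity) (ricePDF_nonneg (by positivity))) (Real.exp_pos _).le

theorem clusterIntegrand_le {lamp mbar σ r z : ℝ} (hl : 0 ≤ lamp) (hm : 0 ≤ mbar) (hσ : 0 < σ)
    (hr : 0 ≤ r) (hz : 0 ≤ z) : clusterIntegrand lamp mbar σ r z ≤
      2 * Real.pi * lamp / σ * ((r / σ) * Real.exp ((r / σ) ^ 2 / 2)) *
        (z * Real.exp (-(1 / (4 * σ ^ 2)) * z ^ 2)) := by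
  rw [clusterIntegrand_eq hσ hr hz]
  have hF := mul_nonneg hm (riceCDF_nonneg (a := z / σ) (div_nonneg hr hσ.le))
  have h1 : Real.exp (-(mbar * riceCDF (z / σ) (r / σ))) ≤ 1 :=
    Real.exp_le_one_iff.2 (by linarith)
  have h2 := ricePDF_le (a := z / σ) (b := r / σ) (by positivity) (by positivity)
  have h3 : -(z / σ) ^ 2 / 4 = -(1 / (4 * σ ^ 2)) * z ^ 2 := by field_simp
  rw [h3] at h2
  have h4 := ricePDF_nonneg (a := z / σ) (b := r / σ) (by positivity)
  calc _ ≤ 2 * Real.pi * lamp * (z / σ) * ((r / σ) * Real.exp ((r / σ) ^ 2 / 2) *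
        Real.exp (-(1 / (4 * σ ^ 2)) * z ^ 2)) := by
        refine (mul_le_of_le_one_right (by positivity) h1).trans ?_
        exact mul_le_mul_of_nonneg_left h2 (by positivity)
    _ = _ := by ring

theorem integrableOn_mul_gaussian {σ : ℝ} (hσ : 0 < σ) (C : ℝ) :
    IntegrableOn (fun z => C * (z * Real.exp (-(1 / (4 * σ ^ 2)) * z ^ 2))) (Ioi 0) :=
  ((integrable_mul_exp_neg_mul_sq (by positivity)).const_mul C).integrableOn

theorem aestronglyMeasurable_voidIntegrand {lamp mbar σ s : ℝ} (hσ : 0 < σ) (hs : 0 ≤ s) :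
    AEStronglyMeasurable (voidIntegrand lamp mbar σ s) (volume.restrict (Ioi 0)) := by
  have hc : Continuous fun z => riceCDF (z / σ) (s / σ) :=
    continuous_riceCDF.comp (by fun_prop : Continuous fun z => (z / σ, s / σ))
  refine AEStronglyMeasurable.congr (f := fun z => 2 * Real.pi * lamp * z *
    (1 - Real.exp (-(mbar * riceCDF (z / σ) (s / σ))))) ?_ ?_
  · exact Continuous.aestronglyMeasurable (by fun_prop)
  · exact (ae_restrict_iff' measurableSet_Ioi).2
      (ae_of_all _ fun z hz => (voidIntegrand_eq hσ hs (le_of_lt hz)).symm)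

theorem aestronglyMeasurable_clusterIntegrand {lamp mbar σ r : ℝ} (hσ : 0 < σ) (hr : 0 ≤ r) :
    AEStronglyMeasurable (clusterIntegrand lamp mbar σ r) (volume.restrict (Ioi 0)) := by
  have hc : Continuous fun z => riceCDF (z / σ) (r / σ) :=
    continuous_riceCDF.comp (by fun_prop : Continuous fun z => (z / σ, r / σ))
  have hp : Continuous fun z => ricePDF (z / σ) (r / σ) :=
    continuous_ricePDF.comp (by fun_prop : Continuous fun z => (z / σ, r / σ))
  refine AEStronglyMeasurable.congr (f := fun z => 2 * Real.pi * lamp * (z / σ) *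
    ricePDF (z / σ) (r / σ) * Real.exp (-(mbar * riceCDF (z / σ) (r / σ)))) ?_ ?_
  · exact Continuous.aestronglyMeasurable (by fun_prop)
  · exact (ae_restrict_iff' measurableSet_Ioi).2
      (ae_of_all _ fun z hz => (clusterIntegrand_eq hσ hr (le_of_lt hz)).symm)

theorem integrableOn_voidIntegrand {lamp mbar σ s : ℝ} (hl : 0 ≤ lamp) (hm : 0 ≤ mbar)
    (hσ : 0 < σ) (hs : 0 ≤ s) : IntegrableOn (voidIntegrand lamp mbar σ s) (Ioi 0) := by
  refine (integrableOn_mul_gaussian hσ (2 * Real.pi * lamp * mbar *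
    ((s / σ) ^ 2 * Real.exp ((s / σ) ^ 2 / 2)))).mono'
    (aestronglyMeasurable_voidIntegrand hσ hs) ?_
  refine (ae_restrict_iff' measurableSet_Ioi).2 (ae_of_all _ fun z hz => ?_)
  rw [Real.norm_of_nonneg (voidIntegrand_nonneg hl hm hσ hs (le_of_lt hz))]
  exact voidIntegrand_le hl hm hσ hs (le_of_lt hz)

theorem integrableOn_clusterIntegrand {lamp mbar σ r : ℝ} (hl : 0 ≤ lamp) (hm : 0 ≤ mbar)
    (hσ : 0 < σ) (hr : 0 ≤ r) : IntegrableOn (clusterIntegrand lamp mbar σ r) (Ioi 0) := by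
  refine (integrableOn_mul_gaussian hσ (2 * Real.pi * lamp / σ *
    ((r / σ) * Real.exp ((r / σ) ^ 2 / 2)))).mono'
    (aestronglyMeasurable_clusterIntegrand hσ hr) ?_
  refine (ae_restrict_iff' measurableSet_Ioi).2 (ae_of_all _ fun z hz => ?_)
  rw [Real.norm_of_nonneg (clusterIntegrand_nonneg hl hσ hr (le_of_lt hz))]
  exact clusterIntegrand_le hl hm hσ hr (le_of_lt hz)

theorem hasDerivAt_voidIntegrand {lamp mbar σ s z : ℝ} (hσ : 0 < σ) (hs : 0 < s) (hz : 0 ≤ z) :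
    HasDerivAt (fun r => voidIntegrand lamp mbar σ r z)
      (mbar * clusterIntegrand lamp mbar σ s z) s := by
  have h1 : HasDerivAt (fun r => 2 * Real.pi * lamp * z *
      (1 - Real.exp (-(mbar * riceCDF (z / σ) (r / σ)))))
      (mbar * clusterIntegrand lamp mbar σ s z) s := by
    have h2 : HasDerivAt (fun r => riceCDF (z / σ) (r / σ))
        (ricePDF (z / σ) (s / σ) * (1 / σ)) s :=
      HasDerivAt.comp (h₂ := riceCDF (z / σ)) s (hasDerivAt_riceCDF (z / σ) (s / σ))
        ((hasDerivAt_id s).div_const σ)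
    have h3 := (((h2.const_mul mbar).neg.exp).const_sub 1).const_mul (2 * Real.pi * lamp * z)
    refine h3.congr_deriv ?_
    rw [clusterIntegrand_eq hσ hs.le hz]
    simp only [Pi.neg_apply]
    ring
  refine h1.congr_of_eventuallyEq ?_
  filter_upwards [lt_mem_nhds hs] with r hr
  exact voidIntegrand_eq hσ hr.le hz

theorem hasDerivAt_voidExponent {lamp mbar σ s : ℝ} (hl : 0 ≤ lamp) (hm : 0 ≤ mbar)
    (hσ : 0 < σ) (hs : 0 < s) : HasDerivAt (voidExponent lamp mbar σ)
      (mbar * ∫ z in Ioi (0 : ℝ), clusterIntegrand lamp mbar σ s z) s := by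
  rw [← integral_const_mul]
  refine (hasDerivAt_integral_of_dominated_loc_of_deriv_le (s := Ioo 0 (s + 1))
    (F' := fun r z => mbar * clusterIntegrand lamp mbar σ r z)
    (bound := fun z => mbar * (2 * Real.pi * lamp / σ *
      (((s + 1) / σ) * Real.exp (((s + 1) / σ) ^ 2 / 2)) *
        (z * Real.exp (-(1 / (4 * σ ^ 2)) * z ^ 2)))) (Ioo_mem_nhds hs (by linarith))
    ?_ (integrableOn_voidIntegrand hl hm hσ hs.le)
    ((aestronglyMeasurable_clusterIntegrand hσ hs.le).const_mul _) ?_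
    ((integrableOn_mul_gaussian hσ _).const_mul mbar) ?_).2
  · filter_upwards [lt_mem_nhds hs] with r hr
    exact aestronglyMeasurable_voidIntegrand hσ hr.le
  · refine (ae_restrict_iff' measurableSet_Ioi).2 (ae_of_all _ fun z hz r hr => ?_)
    have hz' : 0 ≤ z := le_of_lt hz
    rw [Real.norm_of_nonneg (mul_nonneg hm (clusterIntegrand_nonneg hl hσ hr.1.le hz'))]
    refine mul_le_mul_of_nonneg_left ((clusterIntegrand_le hl hm hσ hr.1.le hz').trans ?_) hm
    have h0 := hr.1.le
    have h1 := hr.2.le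
    gcongr
  · exact (ae_restrict_iff' measurableSet_Ioi).2 (ae_of_all _ fun z hz r hr =>
      hasDerivAt_voidIntegrand hσ hr.1 (le_of_lt hz))

theorem voidExponent_nonneg {lamp mbar σ s : ℝ} (hl : 0 ≤ lamp) (hm : 0 ≤ mbar)
    (hσ : 0 < σ) (hs : 0 ≤ s) : 0 ≤ voidExponent lamp mbar σ s :=
  setIntegral_nonneg measurableSet_Ioi fun _ hz => voidIntegrand_nonneg hl hm hσ hs (le_of_lt hz)

theorem voidExponent_zero {lamp mbar σ : ℝ} (hσ : 0 < σ) : voidExponent lamp mbar σ 0 = 0 := by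
  refine setIntegral_eq_zero_of_forall_eq_zero fun z hz => ?_
  rw [voidIntegrand_eq hσ le_rfl (le_of_lt hz)]
  simp [riceCDF]

/-- Continuity at `0` comes from the bound `voidIntegrand_le`, which is of order `s ^ 2`. -/
theorem continuousOn_voidExponent {lamp mbar σ : ℝ} (hl : 0 ≤ lamp) (hm : 0 ≤ mbar)
    (hσ : 0 < σ) : ContinuousOn (voidExponent lamp mbar σ) (Ici 0) := by
  intro s hs
  rcases (mem_Ici.1 hs).eq_or_lt with rfl | hs'
  swap
  · exact (hasDerivAt_voidExponent hl hm hσ hs').continuousAt.continuousWithinAt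
  set K := ∫ z in Ioi (0 : ℝ), z * Real.exp (-(1 / (4 * σ ^ 2)) * z ^ 2)
  have hlim : Filter.Tendsto (fun s : ℝ => 2 * Real.pi * lamp * mbar *
      ((s / σ) ^ 2 * Real.exp ((s / σ) ^ 2 / 2)) * K) (nhdsWithin 0 (Ici 0)) (nhds 0) := by
    have hc : Continuous (fun s : ℝ => 2 * Real.pi * lamp * mbar *
      ((s / σ) ^ 2 * Real.exp ((s / σ) ^ 2 / 2)) * K) := by fun_prop
    have := (hc.tendsto 0).mono_left (nhdsWithin_le_nhds (s := Ici (0 : ℝ)))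
    simpa using this
  rw [ContinuousWithinAt, voidExponent_zero hσ]
  refine tendsto_of_tendsto_of_tendsto_of_le_of_le' tendsto_const_nhds hlim ?_ ?_
  · filter_upwards [self_mem_nhdsWithin] with s hs
    exact voidExponent_nonneg hl hm hσ hs
  · filter_upwards [self_mem_nhdsWithin] with s hs
    rw [← integral_const_mul]
    exact setIntegral_mono_on (integrableOn_voidIntegrand hl hm hσ hs)
      (integrableOn_mul_gaussian hσ _) measurableSet_Ioi fun z hz =>
        voidIntegrand_le hl hm hσ hs (le_of_lt hz)

/-! ### Competing independent distances -/

section Independence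

variable {Ω : Type*} [mΩ : MeasurableSpace Ω] {μ : Measure Ω}

/-- In an event that depends on two independent random elements, one of them may be replaced by
an independent copy. -/
theorem measure_prodMk_mem_eq_lintegral_of_indepFun [IsProbabilityMeasure μ]
    {α β : Type*} [MeasurableSpace α] [MeasurableSpace β] {U : Ω → α} {V : Ω → β}
    (hU : Measurable U) (hV : Measurable V) (h : IndepFun U V μ) {A : Set (α × β)}
    (hA : MeasurableSet A) :
    μ {ω | (U ω, V ω) ∈ A} = ∫⁻ ω, μ {ω' | (U ω, V ω') ∈ A} ∂μ := by
  have hmap := (indepFun_iff_map_prod_eq_prod_map_map hU.aemeasurable hV.aemeasurable).1 h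
  have h1 : μ {ω | (U ω, V ω) ∈ A} = μ.map (fun ω => (U ω, V ω)) A :=
    (Measure.map_apply (hU.prodMk hV) hA).symm
  have : IsProbabilityMeasure (μ.map V) := Measure.isProbabilityMeasure_map hV.aemeasurable
  rw [h1, hmap, Measure.prod_apply hA, lintegral_map (measurable_measure_prodMk_left hA) hU]
  exact lintegral_congr fun ω => Measure.map_apply hV (measurable_prodMk_left hA)

/-- Fubini's theorem for a random element `U` independent of a σ-algebra `m`: in an event that
depends on `U` and on `m`, the value of `U` may be frozen. -/
theorem measure_prodMk_mem_eq_lintegral_of_indep [IsProbabilityMeasure μ] {α : Type*}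
    [mα : MeasurableSpace α] {U : Ω → α} (hU : Measurable U) {m : MeasurableSpace Ω} (hm : m ≤ mΩ)
    (h : Indep (MeasurableSpace.comap U mα) m μ) {A : Set (α × Ω)}
    (hA : @MeasurableSet (α × Ω) (mα.prod m) A) :
    μ {ω | (U ω, ω) ∈ A} = ∫⁻ ω, μ {ω' | (U ω, ω') ∈ A} ∂μ := by
  refine @measure_prodMk_mem_eq_lintegral_of_indepFun Ω mΩ μ _ α Ω mα m U id hU
    (measurable_id'' hm) ?_ A hA
  rw [IndepFun_iff_Indep, MeasurableSpace.comap_id]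
  exact h

/-- The law of a random variable with survival function `exp (-V)` has density
`h * exp (-V)` on the event that it is finite, where `h = V'` is the hazard rate. -/
theorem map_toReal_eq_withDensity [IsProbabilityMeasure μ] {R : Ω → ℝ≥0∞} (hR : Measurable R)
    {V h : ℝ → ℝ} (hV : ContinuousOn V (Ici 0)) (hV0 : V 0 = 0)
    (hder : ∀ s, 0 < s → HasDerivAt V (h s) s) (hpos : ∀ s, 0 < s → 0 ≤ h s)
    (hS : ∀ s, 0 ≤ s → μ {ω | ENNReal.ofReal s < R ω} = ENNReal.ofReal (Real.exp (-V s))) :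
    (μ.restrict {ω | R ω ≠ ∞}).map (fun ω => (R ω).toReal) =
      (volume.restrict (Ioi 0)).withDensity
        (fun r => ENNReal.ofReal (h r * Real.exp (-V r))) := by
  have hRm : Measurable (fun ω => (R ω).toReal) := hR.ennreal_toReal
  have : IsFiniteMeasure ((μ.restrict {ω | R ω ≠ ∞}).map (fun ω => (R ω).toReal)) := by
    infer_instance
  refine Measure.ext_of_Iic _ _ fun a => ?_
  rw [Measure.map_apply hRm measurableSet_Iic,
    Measure.restrict_apply (hRm measurableSet_Iic), withDensity_apply _ measurableSet_Iic,
    Measure.restrict_restrict measurableSet_Iic, inter_comm (Iic a), Ioi_inter_Iic]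
  rcases lt_or_ge a 0 with ha | ha
  · rw [Ioc_eq_empty (not_lt.2 ha.le), setLIntegral_empty]
    convert measure_empty (μ := μ)
    ext ω
    simp only [mem_inter_iff, mem_preimage, mem_Iic, mem_empty_iff_false, iff_false, not_and]
    intro hω
    exact absurd (ENNReal.toReal_nonneg.trans hω) (not_le.2 ha)
  · have hset : (fun ω => (R ω).toReal) ⁻¹' Iic a ∩ {ω | R ω ≠ ∞} =
        {ω | ENNReal.ofReal a < R ω}ᶜ := by
      ext ω
      simp only [mem_inter_iff, mem_preimage, mem_Iic, mem_ofPred_eq, mem_compl_iff, not_lt]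
      constructor
      · rintro ⟨h1, h2⟩
        rw [← ENNReal.ofReal_toReal h2]
        exact ENNReal.ofReal_le_ofReal h1
      · intro h1
        exact ⟨ENNReal.toReal_le_of_le_ofReal ha h1, ne_top_of_le_ne_top ENNReal.ofReal_ne_top h1⟩
    have hcont : ContinuousOn (fun s => -Real.exp (-V s)) (Icc 0 a) :=
      (hV.mono Icc_subset_Ici_self).neg.rexp.neg
    have hd : ∀ s ∈ Ioo 0 a, HasDerivAt (fun s => -Real.exp (-V s))
        (h s * Real.exp (-V s)) s := fun s hs => by
      refine (hder s hs.1).neg.exp.neg.congr_deriv ?_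
      simp only [Pi.neg_apply]
      ring
    have hnn : ∀ s ∈ Ioo 0 a, 0 ≤ h s * Real.exp (-V s) := fun s hs =>
      mul_nonneg (hpos s hs.1) (Real.exp_pos _).le
    have hint := intervalIntegral.integrableOn_deriv_of_nonneg hcont hd hnn
    have hFTC := intervalIntegral.integral_eq_sub_of_hasDerivAt_of_le ha hcont hd
      ((intervalIntegrable_iff_integrableOn_Ioc_of_le ha).2 hint)
    rw [hset, prob_compl_eq_one_sub (measurableSet_lt measurable_const hR), hS a ha,
      ← ofReal_integral_eq_lintegral_ofReal hint, ← intervalIntegral.integral_of_le ha, hFTC, hV0,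
      ← ENNReal.ofReal_one, ← ENNReal.ofReal_sub _ (Real.exp_pos _).le]
    · simp; ring_nf
    · exact (ae_restrict_iff' measurableSet_Ioc).2 (ae_of_all _ fun s hs =>
        mul_nonneg (hpos s hs.1) (Real.exp_pos _).le)

/-- The density is measurable because it is a derivative; nothing is assumed on `h`. -/
theorem aemeasurable_hazard_mul_exp {V h : ℝ → ℝ}
    (hder : ∀ s, 0 < s → HasDerivAt V (h s) s) :
    AEMeasurable (fun r => h r * Real.exp (-V r)) (volume.restrict (Ioi 0)) := by
  refine (measurable_deriv (fun s => -Real.exp (-V s))).aemeasurable.congr ?_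
  refine (ae_restrict_iff' measurableSet_Ioi).2 (ae_of_all _ fun s hs => ?_)
  refine ((hder s hs).neg.exp.neg.congr_deriv ?_).deriv
  simp only [Pi.neg_apply]
  ring

theorem measurableSet_finite_and_forall_mul_lt {Ω : Type*} {m : MeasurableSpace Ω} {ι : Type*}
    [Countable ι] {R : ι → Ω → ℝ≥0∞} {i : ι} (c : ι → ℝ) (hR : ∀ n, n ≠ i → Measurable (R n)) :
    MeasurableSet {p : ℝ≥0∞ × Ω |
      p.1 ≠ ∞ ∧ ∀ n, n ≠ i → ENNReal.ofReal (c n) * p.1 < R n p.2} := by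
  refine MeasurableSet.inter (measurable_fst (measurableSet_singleton ∞).compl) ?_
  change MeasurableSet {p : ℝ≥0∞ × Ω | ∀ n, n ≠ i → ENNReal.ofReal (c n) * p.1 < R n p.2}
  simp only [ofPred_forall]
  refine MeasurableSet.iInter fun n => MeasurableSet.iInter fun hn => ?_
  exact measurableSet_lt (measurable_const.mul measurable_fst) ((hR n hn).comp measurable_snd)

/-- Competing independent distances: the probability that `R i` is finite and that every other
`R n` exceeds `c n * R i`, in terms of the exponents `V n` of the survival functions. -/
theorem measure_forall_mul_lt [IsProbabilityMeasure μ] {ι : Type*} [Fintype ι] [DecidableEq ι]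
    {m : ι → MeasurableSpace Ω} (hm : ∀ n, m n ≤ mΩ) (hind : iIndep m μ) {R : ι → Ω → ℝ≥0∞}
    (hR : ∀ n, Measurable[m n] (R n)) (i : ι) {c : ι → ℝ} (hc : ∀ n, 0 < c n)
    {V : ι → ℝ → ℝ} {h : ℝ → ℝ} (hV : ContinuousOn (V i) (Ici 0)) (hV0 : V i 0 = 0)
    (hder : ∀ s, 0 < s → HasDerivAt (V i) (h s) s) (hpos : ∀ s, 0 < s → 0 ≤ h s)
    (hS : ∀ n s, 0 ≤ s → μ {ω | ENNReal.ofReal s < R n ω} = ENNReal.ofReal (Real.exp (-V n s))) :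
    μ {ω | R i ω ≠ ∞ ∧ ∀ n, n ≠ i → ENNReal.ofReal (c n) * R i ω < R n ω} =
      ∫⁻ r in Ioi (0 : ℝ), ENNReal.ofReal (h r * Real.exp (-V i r) *
        ∏ n ∈ Finset.univ.erase i, Real.exp (-V n (c n * r))) := by
  have hm' : (⨆ n ∈ ({i}ᶜ : Set ι), m n) ≤ mΩ := iSup₂_le fun n _ => hm n
  have hRi : Measurable (R i) := (hR i).mono (hm i) le_rfl
  have hindep : Indep (MeasurableSpace.comap (R i) inferInstance)
      (⨆ n ∈ ({i}ᶜ : Set ι), m n) μ := by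
    refine indep_of_indep_of_le_left (indep_iSup_of_disjoint hm hind
      (disjoint_compl_right (a := ({i} : Set ι)))) ?_
    exact (hR i).comap_le.trans (le_iSup₂_of_le i rfl le_rfl)
  set A : Set (ℝ≥0∞ × Ω) := {p | p.1 ≠ ∞ ∧ ∀ n, n ≠ i → ENNReal.ofReal (c n) * p.1 < R n p.2}
  have hA := measurableSet_finite_and_forall_mul_lt (m := ⨆ n ∈ ({i}ᶜ : Set ι), m n) c
    fun n hn => (hR n).mono
      (le_iSup₂_of_le (f := fun k (_ : k ∈ ({i}ᶜ : Set ι)) => m k) n hn le_rfl) le_rfl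
  have hfub := measure_prodMk_mem_eq_lintegral_of_indep hRi hm' hindep hA
  set g : ℝ → ℝ≥0∞ := fun r =>
    ∏ n ∈ Finset.univ.erase i, μ {ω | ENNReal.ofReal (c n * r) < R n ω}
  -- each factor is antitone in `r`, hence measurable
  have hg : Measurable g := by
    refine Finset.measurable_prod _ fun n _ => Antitone.measurable fun r r' hr => ?_
    refine measure_mono fun ω hω => lt_of_le_of_lt (ENNReal.ofReal_le_ofReal ?_) hω
    exact mul_le_mul_of_nonneg_left hr (hc n).le
  have hsec : ∀ ω, μ {ω' | (R i ω, ω') ∈ A} =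
      ({ω | R i ω ≠ ∞}).indicator (fun ω => g (R i ω).toReal) ω := by
    intro ω
    by_cases hω : R i ω = ∞
    · rw [indicator_of_notMem (by simpa using hω)]
      convert measure_empty (μ := μ)
      ext ω'
      simp [A, hω]
    · rw [indicator_of_mem (by simpa using hω)]
      have hset : {ω' | (R i ω, ω') ∈ A} =
          ⋂ n ∈ Finset.univ.erase i, {ω' | ENNReal.ofReal (c n * (R i ω).toReal) < R n ω'} := by
        ext ω'
        simp only [A, mem_ofPred_eq, mem_iInter, Finset.mem_erase, Finset.mem_univ, and_true,
          ENNReal.ofReal_mul (hc _).le, ENNReal.ofReal_toReal hω]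
        exact and_iff_right hω
      rw [hset, hind.meas_biInter]
      exact fun n _ => hR n measurableSet_Ioi
  change μ {ω | (R i ω, ω) ∈ A} = _
  rw [hfub, lintegral_congr hsec]
  have hms : MeasurableSet {ω | R i ω ≠ ∞} := hRi (measurableSet_singleton ∞).compl
  have hind' : ∫⁻ ω, ({ω | R i ω ≠ ∞}).indicator (fun ω => g (R i ω).toReal) ω ∂μ =
      ∫⁻ ω in {ω | R i ω ≠ ∞}, g (R i ω).toReal ∂μ := lintegral_indicator hms _
  rw [hind', ← lintegral_map hg hRi.ennreal_toReal,
    map_toReal_eq_withDensity hRi hV hV0 hder hpos (hS i),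
    lintegral_withDensity_eq_lintegral_mul₀ (aemeasurable_hazard_mul_exp hder).ennreal_ofReal
      hg.aemeasurable]
  refine setLIntegral_congr_fun measurableSet_Ioi fun r hr => ?_
  have hr' : 0 ≤ r := le_of_lt hr
  simp only [Pi.mul_apply, g]
  rw [ENNReal.ofReal_mul (mul_nonneg (hpos r hr) (Real.exp_pos _).le),
    ENNReal.ofReal_prod_of_nonneg fun _ _ => (Real.exp_pos _).le]
  congr 1
  exact Finset.prod_congr rfl fun n _ => hS n _ (mul_nonneg (hc n).le hr')

end Independence

/-! ### Void events and contact distances -/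

section PointProcess

/-- For a locally finite set the distance is attained, so a strict inequality is equivalent to the
*closed* ball being empty. -/
theorem ofReal_lt_infEDist_iff {S : Set Plane}
    (hS : ∀ ρ : ℝ, (S ∩ Metric.closedBall 0 ρ).Finite) (x : Plane) {s : ℝ} (hs : 0 ≤ s) :
    ENNReal.ofReal s < Metric.infEDist x S ↔ S ∩ Metric.closedBall x s = ∅ := by
  constructor
  · intro h
    rw [eq_empty_iff_forall_notMem]
    rintro y ⟨hy, hyx⟩
    refine absurd ((Metric.infEDist_le_edist_of_mem hy).trans ?_) (not_le.2 h)
    rw [edist_comm, edist_dist]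
    exact ENNReal.ofReal_le_ofReal hyx
  · intro h
    have hfin : (S ∩ Metric.closedBall x (s + 1)).Finite := by
      refine (hS (s + 1 + dist x 0)).subset (inter_subset_inter_right _ ?_)
      exact Metric.closedBall_subset_closedBall' le_rfl
    have hle : min (Metric.infEDist x (S ∩ Metric.closedBall x (s + 1)))
        (ENNReal.ofReal (s + 1)) ≤ Metric.infEDist x S := by
      rw [Metric.le_infEDist]
      intro y hy
      by_cases hyx : dist y x ≤ s + 1
      · exact (min_le_left _ _).trans (Metric.infEDist_le_edist_of_mem ⟨hy, hyx⟩)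
      · refine (min_le_right _ _).trans ?_
        rw [edist_comm, edist_dist]
        exact ENNReal.ofReal_le_ofReal (not_le.1 hyx).le
    refine lt_of_lt_of_le (lt_min ?_ ?_) hle
    · rcases (S ∩ Metric.closedBall x (s + 1)).eq_empty_or_nonempty with he | hne
      · rw [he, Metric.infEDist_empty]
        exact ENNReal.ofReal_lt_top
      · obtain ⟨y, hy, hyd⟩ := hfin.isCompact.exists_infEDist_eq_edist hne x
        rw [hyd, edist_comm, edist_dist]
        have hys : s < dist y x := by
          by_contra hc
          exact (eq_empty_iff_forall_notMem.1 h y) ⟨hy.1, not_lt.1 hc⟩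
        exact (ENNReal.ofReal_lt_ofReal_iff (hs.trans_lt hys)).2 hys
    · exact (ENNReal.ofReal_lt_ofReal_iff (by linarith)).2 (by linarith)

variable {Ω : Type*} [mΩ : MeasurableSpace Ω] {μ : Measure Ω}

theorem IsPointProcess.pointSigma_le {Φ : Ω → Set Plane} (hΦ : IsPointProcess Φ) :
    pointSigma Φ ≤ mΩ :=
  iSup_le fun A => (hΦ.measurable_count A.1 A.2).comap_le

theorem measurable_pointCount {Ω : Type*} {Φ : Ω → Set Plane} {A : Set Plane}
    (hA : MeasurableSet A) : Measurable[pointSigma Φ] (pointCount Φ A) :=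
  Measurable.of_comap_le
    (le_iSup (fun A : {A : Set Plane // MeasurableSet A} =>
      MeasurableSpace.comap (pointCount Φ A.1) inferInstance) ⟨A, hA⟩)

theorem pointCount_eq_zero {Ω : Type*} {Φ : Ω → Set Plane} {A : Set Plane} {ω : Ω} :
    pointCount Φ A ω = 0 ↔ Φ ω ∩ A = ∅ := encard_eq_zero

theorem IsPointProcess.measurable_infEDist {Φ : Ω → Set Plane} (hΦ : IsPointProcess Φ)
    (x : Plane) : Measurable[pointSigma Φ] (fun ω => Metric.infEDist x (Φ ω)) := by
  refine @measurable_of_Ioi _ _ _ _ _ (pointSigma Φ) _ _ _ _ fun a => ?_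
  by_cases ha : a = ∞
  · rw [ha, Ioi_top, preimage_empty]
    exact @MeasurableSet.empty _ (pointSigma Φ)
  · have : (fun ω => Metric.infEDist x (Φ ω)) ⁻¹' Ioi a =
        pointCount Φ (Metric.closedBall x a.toReal) ⁻¹' {0} := by
      ext ω
      rw [mem_preimage, mem_Ioi, mem_preimage, mem_singleton_iff, pointCount_eq_zero,
        ← ofReal_lt_infEDist_iff (hΦ.locallyFinite ω) x ENNReal.toReal_nonneg,
        ENNReal.ofReal_toReal ha]
    rw [this]
    exact measurable_pointCount Metric.isClosed_closedBall.measurableSet (measurableSet_singleton 0)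

theorem IsPoissonProcess.measure_inter_eq_empty {Φ : Ω → Set Plane} {Λ : Measure Plane}
    (hΦ : IsPoissonProcess Φ Λ μ) {A : Set Plane} (hA : MeasurableSet A) (hΛ : Λ A ≠ ∞) :
    μ {ω | Φ ω ∩ A = ∅} = ENNReal.ofReal (Real.exp (-(Λ A).toReal)) := by
  have h1 : {ω | Φ ω ∩ A = ∅} = pointCount Φ A ⁻¹' {0} := by
    ext ω
    exact pointCount_eq_zero.symm
  have h2 : (fun k : ℕ => (k : ℕ∞)) ⁻¹' {0} = {0} := by
    ext k
    simp
  rw [h1, ← Measure.map_apply (hΦ.measurable_count A hA) (measurableSet_singleton 0),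
    hΦ.count_law A hA hΛ, Measure.map_apply (measurable_of_countable _) (measurableSet_singleton 0),
    h2, poissonMeasure_singleton]
  simp [ENNReal.coe_toNNReal_eq_toReal]

/-! ### The Laplace functional of a Poisson process -/

/-- The function `x ↦ exp (-x)` on `[0, ∞]`, with value `0` at `∞`. -/
noncomputable def expNeg (x : ℝ≥0∞) : ℝ≥0∞ := EReal.exp (-(x : EReal))

theorem continuous_expNeg : Continuous expNeg :=
  ENNReal.continuous_exp.comp (continuous_neg.comp continuous_coe_ennreal_ereal)

theorem expNeg_zero : expNeg 0 = 1 := by simp [expNeg]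

theorem expNeg_le_one (x : ℝ≥0∞) : expNeg x ≤ 1 := by
  rw [expNeg, EReal.exp_le_one_iff, EReal.neg_le_zero]
  exact EReal.coe_ennreal_nonneg x

theorem expNeg_antitone : Antitone expNeg := fun _ _ h =>
  EReal.exp_monotone (EReal.neg_le_neg_iff.2 (EReal.coe_ennreal_le_coe_ennreal_iff.2 h))

theorem expNeg_ofReal {a : ℝ} (ha : 0 ≤ a) :
    expNeg (ENNReal.ofReal a) = ENNReal.ofReal (Real.exp (-a)) := by
  rw [expNeg, EReal.coe_ennreal_ofReal, max_eq_left ha, ← EReal.coe_neg, EReal.exp_coe]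

theorem expNeg_add (x y : ℝ≥0∞) : expNeg (x + y) = expNeg x * expNeg y := by
  rw [expNeg, EReal.coe_ennreal_add, EReal.neg_add, sub_eq_add_neg, EReal.exp_add, expNeg, expNeg]
  all_goals simp

theorem expNeg_sum {ι : Type*} (s : Finset ι) (f : ι → ℝ≥0∞) :
    expNeg (∑ i ∈ s, f i) = ∏ i ∈ s, expNeg (f i) := by
  classical
  induction s using Finset.induction_on with
  | empty => simp [expNeg_zero]
  | insert a s ha ih => rw [Finset.sum_insert ha, Finset.prod_insert ha, expNeg_add, ih]

/-- The Laplace transform of a Poisson distribution. -/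
theorem lintegral_expNeg_poissonMeasure (r : ℝ≥0) {a : ℝ≥0∞} (ha : a ≠ ∞) :
    ∫⁻ k : ℕ, expNeg (a * k) ∂poissonMeasure r = expNeg ((1 - expNeg a) * r) := by
  lift a to ℝ≥0 using ha
  have h1 : ∀ k : ℕ, expNeg (a * k) * poissonMeasure r {k} =
      ENNReal.ofReal (Real.exp (-r) * ((r * Real.exp (-a)) ^ k / k.factorial)) := fun k => by
    have : ((a : ℝ≥0∞) * k) = ENNReal.ofReal (a * k) := by
      rw [ENNReal.ofReal_mul a.coe_nonneg, ENNReal.ofReal_coe_nnreal, ENNReal.ofReal_natCast]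
    rw [this, expNeg_ofReal (by positivity), poissonMeasure_singleton,
      ← ENNReal.ofReal_mul (Real.exp_pos _).le, mul_pow, ← Real.exp_nat_mul]
    congr 1
    rw [show -((a : ℝ) * k) = k * -(a : ℝ) by ring]
    ring
  have hsum : HasSum (fun k : ℕ => Real.exp (-r) * ((r * Real.exp (-a)) ^ k / k.factorial))
      (Real.exp (-r) * Real.exp (r * Real.exp (-a))) := by
    refine HasSum.mul_left _ ?_
    rw [Real.exp_eq_exp_ℝ]
    exact NormedSpace.expSeries_div_hasSum_exp _
  rw [lintegral_countable']
  simp only [h1]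
  rw [← ENNReal.ofReal_tsum_of_nonneg (fun k => by positivity) hsum.summable, hsum.tsum_eq,
    ← Real.exp_add]
  have hexp : Real.exp (-(a : ℝ)) ≤ 1 := Real.exp_le_one_iff.2 (by simp)
  have h2 : (1 - expNeg a) * (r : ℝ≥0∞) = ENNReal.ofReal ((1 - Real.exp (-a)) * r) := by
    rw [ENNReal.ofReal_mul (by linarith), ENNReal.ofReal_sub _ (Real.exp_pos _).le,
      ENNReal.ofReal_one, ENNReal.ofReal_coe_nnreal, ← expNeg_ofReal a.coe_nonneg,
      ENNReal.ofReal_coe_nnreal]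
  rw [h2, expNeg_ofReal (mul_nonneg (by linarith) r.coe_nonneg)]
  congr 2
  ring

/-- The case `a = 0` is kept apart since the count in a set of infinite intensity has no
prescribed law. -/
theorem IsPoissonProcess.lintegral_expNeg_mul_pointCount [IsProbabilityMeasure μ]
    {Φ : Ω → Set Plane} {Λ : Measure Plane} (hΦ : IsPoissonProcess Φ Λ μ) {A : Set Plane}
    (hA : MeasurableSet A) {a : ℝ≥0∞} (ha : a ≠ ∞) (h : a = 0 ∨ Λ A ≠ ∞) :
    ∫⁻ ω, expNeg (a * (pointCount Φ A ω : ℝ≥0∞)) ∂μ = expNeg ((1 - expNeg a) * Λ A) := by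
  rcases h with rfl | hΛ
  · simp [expNeg_zero]
  · have hm : Measurable fun k : ℕ∞ => expNeg (a * (k : ℝ≥0∞)) := measurable_from_top
    rw [← lintegral_map hm (hΦ.measurable_count A hA), hΦ.count_law A hA hΛ,
      lintegral_map hm (measurable_of_countable _)]
    simp only [ENat.toENNReal_coe]
    rw [lintegral_expNeg_poissonMeasure _ ha, ENNReal.coe_toNNReal hΛ]

theorem IsPointProcess.countable {Φ : Ω → Set Plane} (hΦ : IsPointProcess Φ) (ω : Ω) :
    (Φ ω).Countable := by
  have : Φ ω = ⋃ n : ℕ, Φ ω ∩ Metric.closedBall 0 n := by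
    rw [← inter_iUnion, Metric.iUnion_closedBall_nat, inter_univ]
  rw [this]
  exact countable_iUnion fun n => (hΦ.locallyFinite ω n).countable

/-- Sums over the points of a process are written as integrals against the counting measure. -/
theorem IsPointProcess.lintegral_simpleFunc {Φ : Ω → Set Plane} (hΦ : IsPointProcess Φ)
    (g : SimpleFunc Plane ℝ≥0∞) (ω : Ω) :
    ∫⁻ x in Φ ω, g x ∂Measure.count =
      ∑ a ∈ g.range, a * (pointCount Φ (g ⁻¹' {a}) ω : ℝ≥0∞) := by
  rw [SimpleFunc.lintegral_eq_lintegral]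
  unfold SimpleFunc.lintegral
  refine Finset.sum_congr rfl fun a _ => ?_
  rw [Measure.restrict_apply (g.measurableSet_fiber a), Measure.count_apply, inter_comm]
  · rfl
  · exact (g.measurableSet_fiber a).inter (hΦ.countable ω).measurableSet

theorem IsPointProcess.measurable_lintegral_simpleFunc {Φ : Ω → Set Plane}
    (hΦ : IsPointProcess Φ) (g : SimpleFunc Plane ℝ≥0∞) :
    Measurable fun ω => ∫⁻ x in Φ ω, g x ∂Measure.count := by
  simp only [hΦ.lintegral_simpleFunc g]
  refine Finset.measurable_sum _ fun a _ => Measurable.const_mul ?_ a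
  exact (measurable_from_top (f := fun k : ℕ∞ => (k : ℝ≥0∞))).comp
    (hΦ.measurable_count _ (g.measurableSet_fiber a))

/-- The Laplace functional at a simple function: counts in disjoint sets are independent. -/
theorem IsPoissonProcess.lintegral_expNeg_simpleFunc [IsProbabilityMeasure μ]
    {Φ : Ω → Set Plane} {Λ : Measure Plane} (hΦ : IsPoissonProcess Φ Λ μ)
    (g : SimpleFunc Plane ℝ≥0∞) (hg : ∀ x, g x ≠ ∞)
    (hfin : ∀ a, a ≠ 0 → Λ (g ⁻¹' {a}) ≠ ∞) :
    ∫⁻ ω, expNeg (∫⁻ x in Φ ω, g x ∂Measure.count) ∂μ =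
      expNeg (∫⁻ x, (1 - expNeg (g x)) ∂Λ) := by
  have hR : ∫⁻ x, (1 - expNeg (g x)) ∂Λ =
      ∑ a ∈ g.range, (1 - expNeg a) * Λ (g ⁻¹' {a}) := by
    rw [← SimpleFunc.map_lintegral (fun a => 1 - expNeg a) g, ← SimpleFunc.lintegral_eq_lintegral]
    rfl
  simp only [hΦ.toIsPointProcess.lintegral_simpleFunc g, hR, expNeg_sum]
  set e := g.range.equivFin.symm
  have hprod : ∀ F : ℝ≥0∞ → ℝ≥0∞, ∏ a ∈ g.range, F a = ∏ k, F (e k) := fun F => by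
    rw [← Finset.prod_coe_sort]
    exact (Equiv.prod_comp e fun a : g.range => F a).symm
  have hind := hΦ.count_indep g.range.card (fun k => g ⁻¹' {(e k : ℝ≥0∞)})
    (fun k => g.measurableSet_fiber _) fun k l hkl => by
      refine Disjoint.preimage g (disjoint_singleton.2 fun h => hkl ?_)
      exact e.injective (Subtype.ext h)
  have hind' := hind.comp (fun k (n : ℕ∞) => expNeg ((e k : ℝ≥0∞) * (n : ℝ≥0∞)))
    fun k => measurable_from_top
  simp only [hprod]
  refine (lintegral_prod_eq_prod_lintegral_of_indepFun Finset.univ _ hind' fun k =>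
    measurable_from_top.comp (hΦ.measurable_count _ (g.measurableSet_fiber _))).trans ?_
  refine Finset.prod_congr rfl fun k _ => ?_
  refine hΦ.lintegral_expNeg_mul_pointCount (g.measurableSet_fiber _) ?_ ?_
  · obtain ⟨x, hx⟩ := SimpleFunc.mem_range.1 (e k).2
    rw [← hx]
    exact hg x
  · by_cases h0 : (e k : ℝ≥0∞) = 0
    · exact Or.inl h0
    · exact Or.inr (hfin _ h0)

/-- The Laplace functional of a Poisson process with locally finite intensity. -/
theorem IsPoissonProcess.lintegral_expNeg [IsProbabilityMeasure μ]
    {Φ : Ω → Set Plane} {Λ : Measure Plane} [IsLocallyFiniteMeasure Λ]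
    (hΦ : IsPoissonProcess Φ Λ μ) {h : Plane → ℝ≥0∞} (hh : Measurable h) :
    ∫⁻ ω, expNeg (∫⁻ x in Φ ω, h x ∂Measure.count) ∂μ =
      expNeg (∫⁻ x, (1 - expNeg (h x)) ∂Λ) := by
  -- cut off to balls, so that the nonzero levels have finite intensity
  set g : ℕ → SimpleFunc Plane ℝ≥0∞ := fun n =>
    (SimpleFunc.eapprox h n).restrict (Metric.closedBall 0 n)
  have hball : ∀ n : ℕ, MeasurableSet (Metric.closedBall (0 : Plane) n) := fun n =>
    Metric.isClosed_closedBall.measurableSet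
  have hgx : ∀ n x, g n x = (Metric.closedBall (0 : Plane) n).indicator
      (SimpleFunc.eapprox h n) x := fun n x => SimpleFunc.restrict_apply _ (hball n) x
  have hmono : Monotone fun n x => g n x := fun n k hnk x => by
    simp only [hgx]
    refine (indicator_le_indicator (SimpleFunc.monotone_eapprox h hnk x)).trans ?_
    refine indicator_le_indicator_of_subset (Metric.closedBall_subset_closedBall ?_)
      (fun _ => zero_le) x
    exact_mod_cast hnk
  have hsup : ∀ x, ⨆ n, g n x = h x := fun x => by
    refine le_antisymm (iSup_le fun n => ?_) ?_
    · rw [hgx, ← SimpleFunc.iSup_eapprox_apply hh x]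
      exact (indicator_le_self' (fun _ _ => zero_le) x).trans
        (le_iSup (fun n => SimpleFunc.eapprox h n x) n)
    · rw [← SimpleFunc.iSup_eapprox_apply hh x]
      refine iSup_le fun n => ?_
      obtain ⟨k, hk⟩ := exists_nat_ge ‖x‖
      refine le_trans ?_ (le_iSup _ (max n k))
      rw [hgx, indicator_of_mem]
      · exact SimpleFunc.monotone_eapprox h (le_max_left n k) x
      · rw [mem_closedBall_zero_iff]
        exact hk.trans (by exact_mod_cast le_max_right n k)
  have hlim : ∀ x, Filter.Tendsto (fun n => g n x) Filter.atTop (nhds (h x)) := fun x => by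
    rw [← hsup x]
    exact tendsto_atTop_iSup fun n k hnk => hmono hnk x
  have heq : ∀ n, ∫⁻ ω, expNeg (∫⁻ x in Φ ω, g n x ∂Measure.count) ∂μ =
      expNeg (∫⁻ x, (1 - expNeg (g n x)) ∂Λ) := fun n => by
    refine hΦ.lintegral_expNeg_simpleFunc (g n) (fun x => ?_) fun a ha => ?_
    · rw [hgx]
      exact ((indicator_le_self' (fun _ _ => zero_le) x).trans_lt
        (SimpleFunc.eapprox_lt_top h n x)).ne
    · refine ((measure_mono fun x hx => ?_).trans_lt
        (isCompact_closedBall (0 : Plane) (n : ℝ)).measure_lt_top).ne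
      by_contra hxb
      refine ha ?_
      rw [mem_preimage, hgx, indicator_of_notMem hxb] at hx
      exact hx.symm
  have hleft : Filter.Tendsto (fun n => ∫⁻ ω, expNeg (∫⁻ x in Φ ω, g n x ∂Measure.count) ∂μ)
      Filter.atTop (nhds (∫⁻ ω, expNeg (∫⁻ x in Φ ω, h x ∂Measure.count) ∂μ)) := by
    refine tendsto_lintegral_of_dominated_convergence (fun _ => 1) (fun n => ?_)
      (fun n => ae_of_all _ fun ω => expNeg_le_one _) (by simp) (ae_of_all _ fun ω => ?_)
    · exact continuous_expNeg.measurable.comp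
        (hΦ.toIsPointProcess.measurable_lintegral_simpleFunc (g n))
    · exact (continuous_expNeg.tendsto _).comp (lintegral_tendsto_of_tendsto_of_monotone
        (fun n => (g n).measurable.aemeasurable) (ae_of_all _ fun x n k hnk => hmono hnk x)
        (ae_of_all _ hlim))
  have hright : Filter.Tendsto (fun n => expNeg (∫⁻ x, (1 - expNeg (g n x)) ∂Λ))
      Filter.atTop (nhds (expNeg (∫⁻ x, (1 - expNeg (h x)) ∂Λ))) := by
    refine (continuous_expNeg.tendsto _).comp (lintegral_tendsto_of_tendsto_of_monotone
      (fun n => ?_) (ae_of_all _ fun x n k hnk => ?_) (ae_of_all _ fun x => ?_))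
    · exact (measurable_const.sub (continuous_expNeg.measurable.comp (g n).measurable)).aemeasurable
    · exact tsub_le_tsub_left (expNeg_antitone (hmono hnk x)) 1
    · exact ENNReal.Tendsto.sub tendsto_const_nhds
        ((continuous_expNeg.tendsto _).comp (hlim x)) (Or.inl ENNReal.one_ne_top)
  simp only [heq] at hleft
  exact tendsto_nhds_unique hleft hright

/-! ### The void probability of the Thomas process -/

theorem measurableSet_forall_lt_infEDist {Ω : Type*} [MeasurableSpace Ω] {Ψ : ℕ → Ω → Set Plane}
    (hΨ : ∀ j x, Measurable fun ω => Metric.infEDist x (Ψ j ω)) (a : ℝ≥0∞) (N : ℕ) :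
    MeasurableSet {p : (ℕ → Plane) × Ω |
      ∀ j ∈ Finset.range N, a < Metric.infEDist (-(p.1 j)) (Ψ j p.2)} := by
  simp only [ofPred_forall]
  refine MeasurableSet.iInter fun j => MeasurableSet.iInter fun _ => ?_
  -- the distance is continuous in the location and measurable in `ω`, hence jointly measurable
  have hu := measurable_uncurry_of_continuous_of_measurable
    (u := fun (x : Plane) ω => Metric.infEDist x (Ψ j ω))
    (fun ω => Metric.continuous_infEDist) (hΨ j)
  refine measurableSet_lt measurable_const (hu.comp (f := fun p : (ℕ → Plane) × Ω =>
    (-(p.1 j), p.2)) ?_)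
  exact ((measurable_pi_apply j).comp measurable_fst).neg.prodMk measurable_snd

theorem iUnion_translate_inter_closedBall_eq_empty {X : ℕ → Plane} {Ψ : ℕ → Set Plane}
    (hΨ : ∀ j (ρ : ℝ), (Ψ j ∩ Metric.closedBall 0 ρ).Finite) {s : ℝ} (hs : 0 ≤ s) :
    (⋃ j, (fun y => X j + y) '' Ψ j) ∩ Metric.closedBall 0 s = ∅ ↔
      ∀ j, ENNReal.ofReal s < Metric.infEDist (-(X j)) (Ψ j) := by
  simp only [ofReal_lt_infEDist_iff (hΨ _) _ hs, eq_empty_iff_forall_notMem, mem_inter_iff,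
    mem_iUnion, mem_image, not_and, Metric.mem_closedBall, dist_eq_norm,
    sub_neg_eq_add, sub_zero]
  constructor
  · intro h j y hy
    rw [add_comm]
    exact h (X j + y) ⟨j, y, hy, rfl⟩
  · rintro h _ ⟨j, y, hy, rfl⟩
    rw [add_comm]
    exact h j y hy

/-- Given the parents, the clusters miss the disc around the origin independently of each other.
The disc is moved to `-(X j ω)` instead of the cluster to `X j ω`. -/
theorem measure_forall_lt_infEDist_marks [IsProbabilityMeasure μ] {X : ℕ → Ω → Plane}
    {Ψ : ℕ → Ω → Set Plane} (hX : ∀ j, Measurable (X j)) {Λ : Measure Plane} [IsFiniteMeasure Λ]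
    (hΨ : ∀ j, IsPoissonProcess (Ψ j) Λ μ) (hind : iIndep (parentMarkSigma X Ψ) μ)
    {s : ℝ} (hs : 0 ≤ s) (N : ℕ) :
    μ {ω | ∀ j ∈ Finset.range N, ENNReal.ofReal s < Metric.infEDist (-(X j ω)) (Ψ j ω)} =
      ∫⁻ ω, ∏ j ∈ Finset.range N, expNeg (Λ (Metric.closedBall (-(X j ω)) s)) ∂μ := by
  have hle : ∀ o, parentMarkSigma X Ψ o ≤ mΩ := by
    rintro (_ | j)
    · exact iSup_le fun j => (hX j).comap_le
    · exact (IsPoissonProcess.toIsPointProcess (hΨ j)).pointSigma_le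
  have hU : Measurable fun ω j => X j ω := measurable_pi_lambda _ hX
  have hindep : Indep (MeasurableSpace.comap (fun ω j => X j ω) inferInstance)
      (⨆ o ∈ ({none}ᶜ : Set (Option ℕ)), parentMarkSigma X Ψ o) μ := by
    refine indep_of_indep_of_le_left (indep_iSup_of_disjoint hle hind
      (disjoint_compl_right (a := ({none} : Set (Option ℕ))))) ?_
    refine le_trans ?_ (le_iSup₂_of_le none rfl le_rfl)
    refine Measurable.comap_le (@measurable_pi_lambda _ _ _ (parentMarkSigma X Ψ none) _ _
      fun j => ?_)
    exact Measurable.of_comap_le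
      (le_iSup (fun j => MeasurableSpace.comap (X j) inferInstance) j)
  have hA := @measurableSet_forall_lt_infEDist Ω
    (⨆ o ∈ ({none}ᶜ : Set (Option ℕ)), parentMarkSigma X Ψ o) Ψ
    (fun j x => ((IsPoissonProcess.toIsPointProcess (hΨ j)).measurable_infEDist x).mono
      (le_iSup₂_of_le (f := fun o (_ : o ∈ ({none}ᶜ : Set (Option ℕ))) => parentMarkSigma X Ψ o)
        (some j) (by simp) le_rfl) le_rfl) (ENNReal.ofReal s) N
  refine (measure_prodMk_mem_eq_lintegral_of_indep hU (iSup₂_le fun o _ => hle o) hindep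
    hA).trans ?_
  refine lintegral_congr fun ω => ?_
  have hind' : iIndep (parentMarkSigma X Ψ ∘ some) μ := hind.precomp (Option.some_injective ℕ)
  have hset : {ω' | ((fun j => X j ω), ω') ∈ {p : (ℕ → Plane) × Ω |
      ∀ j ∈ Finset.range N, ENNReal.ofReal s < Metric.infEDist (-(p.1 j)) (Ψ j p.2)}} =
      ⋂ j ∈ Finset.range N, {ω' | ENNReal.ofReal s < Metric.infEDist (-(X j ω)) (Ψ j ω')} := by
    ext ω'
    simp
  have hmeas : ∀ j ∈ Finset.range N, MeasurableSet[(parentMarkSigma X Ψ ∘ some) j]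
      {ω' | ENNReal.ofReal s < Metric.infEDist (-(X j ω)) (Ψ j ω')} := fun j _ =>
    (IsPoissonProcess.toIsPointProcess (hΨ j)).measurable_infEDist (-(X j ω)) measurableSet_Ioi
  rw [hset, hind'.meas_biInter hmeas]
  refine Finset.prod_congr rfl fun j _ => ?_
  have hvoid := (hΨ j).measure_inter_eq_empty
    (Metric.isClosed_closedBall (x := -(X j ω)) (ε := s)).measurableSet (measure_ne_top _ _)
  rw [← expNeg_ofReal ENNReal.toReal_nonneg, ENNReal.ofReal_toReal (measure_ne_top _ _)] at hvoid
  rw [← hvoid]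
  congr 1
  ext ω'
  exact ofReal_lt_infEDist_iff ((hΨ j).locallyFinite ω') _ hs

theorem isFiniteMeasure_daughterIntensity {mbar σ : ℝ} (hm : 0 ≤ mbar) (hσ : 0 < σ) :
    IsFiniteMeasure (daughterIntensity mbar σ) := by
  refine ⟨?_⟩
  have hmk : Measurable fun w : Plane => ENNReal.ofReal (displacementKernel σ w) := by
    unfold displacementKernel; fun_prop
  rw [daughterIntensity, withDensity_apply _ MeasurableSet.univ, Measure.restrict_univ]
  simp only [ENNReal.ofReal_mul hm]
  rw [lintegral_const_mul _ hmk, lintegral_displacementKernel hσ, mul_one]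
  exact ENNReal.ofReal_lt_top

/-- The exponent of the Laplace functional of the parents, in polar coordinates. -/
theorem lintegral_one_sub_expNeg_riceCDF {lamp mbar σ s : ℝ} (hl : 0 ≤ lamp) (hm : 0 ≤ mbar)
    (hσ : 0 < σ) (hs : 0 ≤ s) :
    ∫⁻ x : Plane, (1 - expNeg (ENNReal.ofReal (mbar * riceCDF (‖x‖ / σ) (s / σ))))
        ∂(ENNReal.ofReal lamp • volume) =
      ENNReal.ofReal (voidExponent lamp mbar σ s) := by
  have hc : Continuous fun z => riceCDF (z / σ) (s / σ) :=
    continuous_riceCDF.comp (by fun_prop : Continuous fun z => (z / σ, s / σ))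
  have hφ : Measurable fun z => 1 - expNeg (ENNReal.ofReal (mbar * riceCDF (z / σ) (s / σ))) :=
    measurable_const.sub (continuous_expNeg.measurable.comp
      (measurable_const.mul hc.measurable).ennreal_ofReal)
  rw [lintegral_smul_measure, lintegral_plane_norm hφ, smul_eq_mul,
    ← lintegral_const_mul' _ _ ENNReal.ofReal_ne_top, voidExponent,
    ofReal_integral_eq_lintegral_ofReal (integrableOn_voidIntegrand hl hm hσ hs)
      ((ae_restrict_iff' measurableSet_Ioi).2 (ae_of_all _ fun z hz =>
        voidIntegrand_nonneg hl hm hσ hs (le_of_lt hz)))]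
  refine setLIntegral_congr_fun measurableSet_Ioi fun z hz => ?_
  have hz' : 0 ≤ z := le_of_lt hz
  have hF := mul_nonneg hm (riceCDF_nonneg (a := z / σ) (div_nonneg hs hσ.le))
  rw [voidIntegrand_eq hσ hs hz', expNeg_ofReal hF, ← ENNReal.ofReal_one,
    ← ENNReal.ofReal_sub _ (Real.exp_pos _).le, ← ENNReal.ofReal_mul (by positivity),
    ← ENNReal.ofReal_mul hl]
  congr 1
  ring

theorem IsThomasProcess.measure_inter_closedBall_eq_empty [IsProbabilityMeasure μ]
    {Φ : Ω → Set Plane} {lamp mbar σ : ℝ} (hΦ : IsThomasProcess Φ lamp mbar σ μ) (hl : 0 ≤ lamp)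
    (hm : 0 ≤ mbar) (hσ : 0 < σ) {s : ℝ} (hs : 0 ≤ s) :
    μ {ω | Φ ω ∩ Metric.closedBall 0 s = ∅} =
      ENNReal.ofReal (Real.exp (-voidExponent lamp mbar σ s)) := by
  obtain ⟨X, Ψ, hX, hinj, hpois, hΨ, hind, hU⟩ := hΦ.exists_clusters
  have hfin := isFiniteMeasure_daughterIntensity hm hσ
  have : IsLocallyFiniteMeasure (ENNReal.ofReal lamp • (volume : Measure Plane)) :=
    ⟨fun x => ⟨Metric.ball x 1, Metric.ball_mem_nhds x one_pos, by
      rw [Measure.smul_apply, smul_eq_mul]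
      exact ENNReal.mul_lt_top ENNReal.ofReal_lt_top measure_ball_lt_top⟩⟩
  set H : Plane → ℝ≥0∞ := fun x => ENNReal.ofReal (mbar * riceCDF (‖x‖ / σ) (s / σ))
  have hH : Measurable H := by
    have hc : Continuous fun x : Plane => riceCDF (‖x‖ / σ) (s / σ) :=
      continuous_riceCDF.comp (by fun_prop : Continuous fun x : Plane => (‖x‖ / σ, s / σ))
    exact (measurable_const.mul hc.measurable).ennreal_ofReal
  -- `E N`: none of the first `N` clusters meets the disc
  set E : ℕ → Set Ω := fun N =>
    {ω | ∀ j ∈ Finset.range N, ENNReal.ofReal s < Metric.infEDist (-(X j ω)) (Ψ j ω)}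
  have hE : ∀ N, μ (E N) = ∫⁻ ω, expNeg (∑ j ∈ Finset.range N, H (X j ω)) ∂μ := fun N => by
    rw [measure_forall_lt_infEDist_marks hX hΨ hind hs N]
    refine lintegral_congr fun ω => ?_
    rw [expNeg_sum]
    refine Finset.prod_congr rfl fun j _ => ?_
    rw [daughterIntensity_closedBall hm hσ hs, norm_neg]
  have hEmeas : ∀ N, MeasurableSet (E N) := fun N =>
    ((measurable_pi_lambda _ hX).prodMk measurable_id) (measurableSet_forall_lt_infEDist
      (fun j x => ((IsPoissonProcess.toIsPointProcess (hΨ j)).measurable_infEDist x).mono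
        (IsPoissonProcess.toIsPointProcess (hΨ j)).pointSigma_le le_rfl) (ENNReal.ofReal s) N)
  have hevent : {ω | Φ ω ∩ Metric.closedBall 0 s = ∅} =ᵐ[μ] ⋂ N, E N := by
    filter_upwards [hU] with ω hω
    refine propext ?_
    change Φ ω ∩ Metric.closedBall 0 s = ∅ ↔ ω ∈ ⋂ N, E N
    rw [hω, iUnion_translate_inter_closedBall_eq_empty (fun j => (hΨ j).locallyFinite ω) hs,
      mem_iInter]
    exact ⟨fun h N j _ => h j, fun h j => h (j + 1) j (Finset.self_mem_range_succ j)⟩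
  have hlim1 : Filter.Tendsto (fun N => μ (E N)) Filter.atTop (nhds (μ (⋂ N, E N))) :=
    tendsto_measure_iInter_atTop (fun N => (hEmeas N).nullMeasurableSet)
      (fun N M hNM ω hω j hj => hω j (Finset.range_mono hNM hj)) ⟨0, measure_ne_top _ _⟩
  have hlim2 : Filter.Tendsto (fun N => μ (E N)) Filter.atTop
      (nhds (∫⁻ ω, expNeg (∑' j, H (X j ω)) ∂μ)) := by
    simp only [hE]
    refine tendsto_lintegral_of_dominated_convergence (fun _ => 1) (fun N => ?_)
      (fun N => ae_of_all _ fun ω => expNeg_le_one _) (by simp) (ae_of_all _ fun ω => ?_)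
    · exact continuous_expNeg.measurable.comp
        (Finset.measurable_sum _ fun j _ => hH.comp (hX j))
    · exact (continuous_expNeg.tendsto _).comp ENNReal.summable.hasSum.tendsto_sum_nat
  -- the parents are distinct, so the sum over indices is the sum over points
  have hcount : ∀ᵐ ω ∂μ, expNeg (∑' j, H (X j ω)) =
      expNeg (∫⁻ x in range (fun j => X j ω), H x ∂Measure.count) := by
    filter_upwards [hinj] with ω hω
    rw [← lintegral_indicator (countable_range _).measurableSet, lintegral_count, ← tsum_subtype,
      tsum_range H hω]
  rw [measure_congr hevent, tendsto_nhds_unique hlim1 hlim2, lintegral_congr_ae hcount,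
    hpois.lintegral_expNeg hH, lintegral_one_sub_expNeg_riceCDF hl hm hσ hs,
    expNeg_ofReal (voidExponent_nonneg hl hm hσ hs)]

theorem IsHomogeneousPoisson.measure_inter_closedBall_eq_empty
    {Φ : Ω → Set Plane} {lam : ℝ} (hΦ : IsHomogeneousPoisson Φ lam μ) (hl : 0 ≤ lam)
    {s : ℝ} (hs : 0 ≤ s) :
    μ {ω | Φ ω ∩ Metric.closedBall 0 s = ∅} =
      ENNReal.ofReal (Real.exp (-(Real.pi * lam * s ^ 2))) := by
  have hΛ : (ENNReal.ofReal lam • (volume : Measure Plane)) (Metric.closedBall 0 s) =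
      ENNReal.ofReal (Real.pi * lam * s ^ 2) := by
    rw [Measure.smul_apply, EuclideanSpace.volume_closedBall_fin_two, smul_eq_mul,
      ← ENNReal.ofReal_pow hs, ← ENNReal.ofReal_mul (by positivity), ← ENNReal.ofReal_mul hl]
    congr 1
    ring
  rw [IsPoissonProcess.measure_inter_eq_empty hΦ Metric.isClosed_closedBall.measurableSet
    (by rw [hΛ]; exact ENNReal.ofReal_ne_top), hΛ, ENNReal.toReal_ofReal (by positivity)]

end PointProcess

/-! ### Association probabilities -/

/-- Comparison of received powers in terms of contact distances. The conventions agree in the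
degenerate cases: a distance `∞` gives power `0`, a distance `0` gives power `∞`. -/
theorem receivedPower_lt_iff {P Q β : ℝ} (hP : 0 < P) (hQ : 0 < Q) (hβ : 0 < β)
    (S T : Set Plane) :
    receivedPower P β S < receivedPower Q β T ↔
      contactDistance T ≠ ∞ ∧
        ENNReal.ofReal ((P / Q) ^ (1 / β)) * contactDistance T < contactDistance S := by
  unfold receivedPower
  generalize contactDistance S = x
  generalize contactDistance T = y
  have hc : 0 < (P / Q) ^ (1 / β) := by positivity
  set c := ENNReal.ofReal ((P / Q) ^ (1 / β))
  have hc0 : c ≠ 0 := (ENNReal.ofReal_pos.2 hc).ne'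
  have hct : c ≠ ∞ := ENNReal.ofReal_ne_top
  by_cases hy : y = ∞
  · simp [hy, hβ]
  · have hPc : ENNReal.ofReal P = ENNReal.ofReal Q * c ^ β := by
      rw [ENNReal.ofReal_rpow_of_pos hc, ← ENNReal.ofReal_mul hQ.le,
        ← Real.rpow_mul (by positivity), one_div_mul_cancel hβ.ne', Real.rpow_one, mul_div_cancel₀ _ hQ.ne']
    have hQ0 : ENNReal.ofReal Q ≠ 0 := (ENNReal.ofReal_pos.2 hQ).ne'
    rw [hPc, mul_assoc, ENNReal.mul_lt_mul_iff_right hQ0 ENNReal.ofReal_ne_top]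
    have h1 : c ^ β * x ^ (-β) = (x / c) ^ (-β) := by
      have hcβ : c ^ β ≠ 0 := (ENNReal.rpow_pos (pos_iff_ne_zero.2 hc0) hct).ne'
      rw [ENNReal.rpow_neg, ENNReal.rpow_neg, ENNReal.div_rpow_of_nonneg _ _ hβ.le, ENNReal.inv_div
        (Or.inl (ENNReal.rpow_ne_top_of_nonneg hβ.le hct)) (Or.inl hcβ), div_eq_mul_inv]
    rw [h1, ENNReal.rpow_neg, ENNReal.rpow_neg, ENNReal.inv_lt_inv, ENNReal.rpow_lt_rpow_iff hβ,
      ENNReal.lt_div_iff_mul_lt (Or.inl hc0) (Or.inl hct), mul_comm]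
    exact (and_iff_right hy).symm

/-- Minus the logarithm of the probability that tier `n` has no point within distance `s` of the
origin. -/
noncomputable def tierExponent (lam1 lam3 lamp mbar σ : ℝ) (n : Fin 3) (s : ℝ) : ℝ :=
  match n with
  | 0 => Real.pi * lam1 * s ^ 2
  | 1 => voidExponent lamp mbar σ s
  | 2 => Real.pi * lam3 * s ^ 2

section

variable {lam1 lam3 lamp mbar σ : ℝ}

theorem continuousOn_tierExponent (hlamp : 0 ≤ lamp) (hmbar : 0 ≤ mbar) (hσ : 0 < σ) (n : Fin 3) :
    ContinuousOn (tierExponent lam1 lam3 lamp mbar σ n) (Ici 0) := by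
  fin_cases n
  · exact Continuous.continuousOn (by unfold tierExponent; fun_prop)
  · exact continuousOn_voidExponent hlamp hmbar hσ
  · exact Continuous.continuousOn (by unfold tierExponent; fun_prop)

theorem tierExponent_zero (hσ : 0 < σ) (n : Fin 3) :
    tierExponent lam1 lam3 lamp mbar σ n 0 = 0 := by
  fin_cases n
  · simp [tierExponent]
  · exact voidExponent_zero hσ
  · simp [tierExponent]

/-- `tau i` is the hazard rate of the contact distance of tier `i`. -/
theorem hasDerivAt_tierExponent (hlamp : 0 ≤ lamp) (hmbar : 0 ≤ mbar) (hσ : 0 < σ) (n : Fin 3)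
    {s : ℝ} (hs : 0 < s) : HasDerivAt (tierExponent lam1 lam3 lamp mbar σ n)
      (tau lam1 lam3 lamp mbar σ n s) s := by
  have hsq : ∀ lam : ℝ, HasDerivAt (fun s : ℝ => Real.pi * lam * s ^ 2) (2 * Real.pi * lam * s) s :=
    fun lam => ((hasDerivAt_pow 2 s).const_mul (Real.pi * lam)).congr_deriv (by
      push_cast
      ring)
  fin_cases n
  · exact hsq lam1
  · exact hasDerivAt_voidExponent hlamp hmbar hσ hs
  · exact hsq lam3

theorem tau_nonneg (hlam1 : 0 ≤ lam1) (hlam3 : 0 ≤ lam3) (hlamp : 0 ≤ lamp) (hmbar : 0 ≤ mbar)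
    (hσ : 0 < σ) (n : Fin 3) {s : ℝ} (hs : 0 ≤ s) : 0 ≤ tau lam1 lam3 lamp mbar σ n s := by
  fin_cases n
  · change 0 ≤ 2 * Real.pi * lam1 * s
    positivity
  · exact mul_nonneg hmbar (setIntegral_nonneg measurableSet_Ioi fun _ hz =>
      clusterIntegrand_nonneg hlamp hσ hs (le_of_lt hz))
  · change 0 ≤ 2 * Real.pi * lam3 * s
    positivity

/-- The term `n = i` of the product is split off, since `c i = 1`, and makes `tau i` the density of
the contact distance of tier `i`. -/
theorem associationIntegrand_eq {β : ℝ} {P : Fin 3 → ℝ} (hP : ∀ n, 0 < P n) (i : Fin 3) (r : ℝ) :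
    associationIntegrand lam1 lam3 lamp mbar σ β P i r =
      tau lam1 lam3 lamp mbar σ i r * Real.exp (-tierExponent lam1 lam3 lamp mbar σ i r) *
        ∏ n ∈ Finset.univ.erase i,
          Real.exp (-tierExponent lam1 lam3 lamp mbar σ n ((P n / P i) ^ (1 / β) * r)) := by
  have hi : tierExponent lam1 lam3 lamp mbar σ i r =
      tierExponent lam1 lam3 lamp mbar σ i ((P i / P i) ^ (1 / β) * r) := by
    rw [div_self (hP i).ne', Real.one_rpow, one_mul]
  have hsq : ∀ n, ((P n / P i) ^ (1 / β) * r) ^ 2 = (P n / P i) ^ (2 / β) * r ^ 2 := fun n => by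
    rw [mul_pow, ← Real.rpow_mul_natCast (div_pos (hP n) (hP i)).le]
    congr 2
    push_cast
    ring
  rw [hi, mul_assoc, Finset.mul_prod_erase Finset.univ
    (fun n => Real.exp (-tierExponent lam1 lam3 lamp mbar σ n ((P n / P i) ^ (1 / β) * r)))
    (Finset.mem_univ i), Fin.prod_univ_three]
  simp only [tierExponent, hsq]
  rw [associationIntegrand, mul_assoc, ← voidExponent, ← Real.exp_add, ← Real.exp_add,
    ← Real.exp_add]
  congr 2
  ring

end

end HetNet

theorem corollary1 {Ω : Type*} [MeasurableSpace Ω] (μ : Measure Ω) [IsProbabilityMeasure μ]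
    (lam1 lam3 lamp mbar σ β : ℝ) (P : Fin 3 → ℝ)
    (hlam1 : 0 ≤ lam1) (hlam3 : 0 ≤ lam3) (hlamp : 0 < lamp) (hmbar : 0 < mbar)
    (hσ : 0 < σ) (hβ : 0 < β) (hP : ∀ n, 0 < P n)
    (Φ : Fin 3 → Ω → Set HetNet.Plane)
    (hΦ1 : HetNet.IsHomogeneousPoisson (Φ 0) lam1 μ)
    (hΦ2 : HetNet.IsThomasProcess (Φ 1) lamp mbar σ μ)
    (hΦ3 : HetNet.IsHomogeneousPoisson (Φ 2) lam3 μ)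
    (hindep : iIndep (fun n => HetNet.pointSigma (Φ n)) μ)
    (i : Fin 3) :
    (∀ s : ℝ, 0 < s → IntegrableOn (HetNet.voidIntegrand lamp mbar σ s) (Ioi 0)) ∧
    (∀ r : ℝ, 0 < r → IntegrableOn (HetNet.clusterIntegrand lamp mbar σ r) (Ioi 0)) ∧
    IntegrableOn (HetNet.associationIntegrand lam1 lam3 lamp mbar σ β P i) (Ioi 0) ∧
    μ.real {ω | ∀ n, n ≠ i →
        HetNet.receivedPower (P n) β (Φ n ω) < HetNet.receivedPower (P i) β (Φ i ω)} =
      ∫ r in Ioi (0 : ℝ), HetNet.associationIntegrand lam1 lam3 lamp mbar σ β P i r := by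
  refine ⟨fun s hs => HetNet.integrableOn_voidIntegrand hlamp.le hmbar.le hσ hs.le,
    fun r hr => HetNet.integrableOn_clusterIntegrand hlamp.le hmbar.le hσ hr.le, ?_⟩
  have hpp : ∀ n, HetNet.IsPointProcess (Φ n) := by
    intro n
    fin_cases n
    · exact HetNet.IsPoissonProcess.toIsPointProcess hΦ1
    · exact hΦ2.toIsPointProcess
    · exact HetNet.IsPoissonProcess.toIsPointProcess hΦ3
  set V := HetNet.tierExponent lam1 lam3 lamp mbar σ
  set c : Fin 3 → ℝ := fun n => (P n / P i) ^ (1 / β)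
  have hc : ∀ n, 0 < c n := fun n => Real.rpow_pos_of_pos (div_pos (hP n) (hP i)) _
  have hvoid : ∀ n s, 0 ≤ s → μ {ω | ENNReal.ofReal s < HetNet.contactDistance (Φ n ω)} =
      ENNReal.ofReal (Real.exp (-V n s)) := by
    intro n s hs
    have hset : {ω | ENNReal.ofReal s < HetNet.contactDistance (Φ n ω)} =
        {ω | Φ n ω ∩ Metric.closedBall 0 s = ∅} := by
      ext ω
      exact HetNet.ofReal_lt_infEDist_iff ((hpp n).locallyFinite ω) 0 hs
    rw [hset]
    fin_cases n
    · exact HetNet.IsHomogeneousPoisson.measure_inter_closedBall_eq_empty hΦ1 hlam1 hs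
    · exact hΦ2.measure_inter_closedBall_eq_empty hlamp.le hmbar.le hσ hs
    · exact HetNet.IsHomogeneousPoisson.measure_inter_closedBall_eq_empty hΦ3 hlam3 hs
  have hder := fun s (hs : 0 < s) => HetNet.hasDerivAt_tierExponent (lam1 := lam1) (lam3 := lam3)
    hlamp.le hmbar.le hσ i hs
  have hevent : {ω | ∀ n, n ≠ i →
      HetNet.receivedPower (P n) β (Φ n ω) < HetNet.receivedPower (P i) β (Φ i ω)} =
      {ω | HetNet.contactDistance (Φ i ω) ≠ ∞ ∧ ∀ n, n ≠ i →
        ENNReal.ofReal (c n) * HetNet.contactDistance (Φ i ω) <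
          HetNet.contactDistance (Φ n ω)} := by
    ext ω
    -- a second tier is needed for the comparison to force `R i < ∞`
    have hn : ∃ n, n ≠ i := exists_ne i
    simp only [mem_ofPred_eq, HetNet.receivedPower_lt_iff (hP _) (hP i) hβ]
    constructor
    · intro h
      exact ⟨(h _ hn.choose_spec).1, fun n hni => (h n hni).2⟩
    · exact fun h n hni => ⟨h.1, h.2 n hni⟩
  have hmeasure := HetNet.measure_forall_mul_lt (fun n => (hpp n).pointSigma_le) hindep
    (R := fun n ω => HetNet.contactDistance (Φ n ω)) (fun n => (hpp n).measurable_infEDist 0) i hc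
    (HetNet.continuousOn_tierExponent hlamp.le hmbar.le hσ i) (HetNet.tierExponent_zero hσ i) hder
    (fun s hs => HetNet.tau_nonneg hlam1 hlam3 hlamp.le hmbar.le hσ i hs.le) hvoid
  rw [← hevent] at hmeasure
  simp only [c, ← HetNet.associationIntegrand_eq hP] at hmeasure
  have hnn : 0 ≤ᵐ[volume.restrict (Ioi 0)]
      HetNet.associationIntegrand lam1 lam3 lamp mbar σ β P i := by
    refine (ae_restrict_iff' measurableSet_Ioi).2 (ae_of_all _ fun r hr => ?_)
    exact mul_nonneg (mul_nonneg (HetNet.tau_nonneg hlam1 hlam3 hlamp.le hmbar.le hσ i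
      (le_of_lt hr)) (Real.exp_pos _).le) (Real.exp_pos _).le
  have hmeas : AEStronglyMeasurable (HetNet.associationIntegrand lam1 lam3 lamp mbar σ β P i)
      (volume.restrict (Ioi 0)) := by
    refine AEMeasurable.aestronglyMeasurable ?_
    rw [funext (HetNet.associationIntegrand_eq (lam1 := lam1) (lam3 := lam3) (lamp := lamp)
      (mbar := mbar) (σ := σ) (β := β) hP i)]
    refine (HetNet.aemeasurable_hazard_mul_exp hder).mul
      (Finset.aemeasurable_fun_prod _ fun n _ => ?_)
    refine ContinuousOn.aemeasurable ?_ measurableSet_Ioi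
    refine ((HetNet.continuousOn_tierExponent hlamp.le hmbar.le hσ n).comp
      (continuous_const.mul continuous_id).continuousOn fun r hr => ?_).neg.rexp
    exact mul_nonneg (hc n).le (le_of_lt hr)
  refine ⟨⟨hmeas, ?_⟩, ?_⟩
  · rw [hasFiniteIntegral_iff_ofReal hnn, ← hmeasure]
    exact measure_lt_top _ _
  · rw [integral_eq_lintegral_of_nonneg_ae hnn hmeas, ← hmeasure, Measure.real]
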